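/- Let $\mu_X,\mu_Y,\mu_Z$ be Borel probability measures on $\mathbb R$ in convex order, $\mu_X\preceq_c\mu_Y\preceq_c\mu_Z$ (that is, $\int\varphi\,d\mu_X\le\int\varphi\,d\mu_Y\le\int\varphi\,d\mu_Z$ for every convex $\varphi:\mathbb R\to\mathbb R$). Assume: (A1) $\mu_X$ is concentrated on a compact interval $X=[\underline x,\overline x]$ and is absolutely continuous with respect to Lebesgue measure; (A2) $\mu_Y=\sum_{i=0}^2 a_i\delta_{y_i}$ with $a_i>0$ and $y_0<y_1<y_2$; (A3) $\mu_Z$ has no atoms and is concentrated on $Z_-\cup Z_+$, where $Z_-=[\underline{z_-},\overline{z_-}]$, $Z_+=[\underline{z_+},\overline{z_+}]$ and $\overline{z_-}<y_0$, $y_2<\underline{z_+}$; (A4) $c(x,y,z)=f(x,y)\,z^2$, where $f$ is differentiable on $X\times[y_0,y_2]$ with $\partial_x f<0$ and $\partial_y f<0$ there (one-sided derivatives at the boundary). Let $\Pi_M(\mu_X,\mu_Y,\mu_Z)$ be the set of Borel probability measures $\pi$ on $\mathbb R^3$ with one-dimensional marginals $\mu_X,\mu_Y,\mu_Z$ such that,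 if $(x,y,z)$ has law $\pi$, the conditional mean of $y$ given $x$ is $x$ and the conditional mean of $z$ given $(x,y)$ is $y$, $\pi$-almost surely. Theorem. The three-period martingale optimal transport problem $$\min_{\pi\in\Pi_M(\mu_X,\mu_Y,\mu_Z)}\int c(x,y,z)\,d\pi(x,y,z)$$ has a unique solution: there is exactly one $\pi\in\Pi_M(\mu_X,\mu_Y,\mu_Z)$ with $\int c\,d\pi\le\int c\,d\pi'$ for all $\pi'\in\Pi_M(\mu_X,\mu_Y,\mu_Z)$. -/

import Mathlib

open MeasureTheory ProbabilityTheory Set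

noncomputable section

/-- Convex order `μ ⪯_c ν` of measures on the real line. (It is only used for probability measures
with bounded support, for which every convex function on `ℝ` is integrable.) -/
def ConvexOrder (μ ν : Measure ℝ) : Prop :=
  ∀ φ : ℝ → ℝ, ConvexOn ℝ univ φ → ∫ t, φ t ∂μ ≤ ∫ t, φ t ∂ν

/-- The set `Π(μX, μY, μZ)` of couplings: probability measures on `ℝ × ℝ × ℝ` with the prescribed
one-dimensional marginals. -/
def Couplings (μX μY μZ : Measure ℝ) : Set (ProbabilityMeasure (ℝ × ℝ × ℝ)) :=
  {π | (π : Measure (ℝ × ℝ × ℝ)).map (fun p => p.1) = μX ∧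
       (π : Measure (ℝ × ℝ × ℝ)).map (fun p => p.2.1) = μY ∧
       (π : Measure (ℝ × ℝ × ℝ)).map (fun p => p.2.2) = μZ}

/-- The conditional probability of `(y, z)` given `x`, for `(x, y, z)` with law `π`. -/
def kernelGivenX (π : ProbabilityMeasure (ℝ × ℝ × ℝ)) : Kernel ℝ (ℝ × ℝ) :=
  (π : Measure (ℝ × ℝ × ℝ)).condKernel

/-- The law `π` of `(x, y, z)`, seen as the law of `((x, y), z)`. -/
def regroup (π : ProbabilityMeasure (ℝ × ℝ × ℝ)) : Measure ((ℝ × ℝ) × ℝ) :=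
  (π : Measure (ℝ × ℝ × ℝ)).map MeasurableEquiv.prodAssoc.symm

instance (π : ProbabilityMeasure (ℝ × ℝ × ℝ)) : IsProbabilityMeasure (regroup π) :=
  Measure.isProbabilityMeasure_map MeasurableEquiv.prodAssoc.symm.measurable.aemeasurable

/-- The conditional probability of `z` given `(x, y)`, for `(x, y, z)` with law `π`. -/
def kernelGivenXY (π : ProbabilityMeasure (ℝ × ℝ × ℝ)) : Kernel (ℝ × ℝ) ℝ :=
  (regroup π).condKernel

/-- The set `Π_M(μX, μY, μZ)` of martingale couplings: the mean of `y` given `x` is `x`, and the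
mean of `z` given `(x, y)` is `y`, almost surely. -/
def MartingaleCouplings (μX μY μZ : Measure ℝ) : Set (ProbabilityMeasure (ℝ × ℝ × ℝ)) :=
  {π | π ∈ Couplings μX μY μZ ∧
       (∀ᵐ x ∂(π : Measure (ℝ × ℝ × ℝ)).fst, ∫ q, q.1 ∂(kernelGivenX π x) = x) ∧
       (∀ᵐ p ∂(regroup π).fst, ∫ z, z ∂(kernelGivenXY π p) = p.2)}

/-- `π` solves the three-period martingale optimal transport problem
`min {∫ c dπ : π ∈ Π_M(μX, μY, μZ)}`. -/
def IsOptimalMOT (c : ℝ → ℝ → ℝ → ℝ) (μX μY μZ : Measure ℝ)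
    (π : ProbabilityMeasure (ℝ × ℝ × ℝ)) : Prop :=
  π ∈ MartingaleCouplings μX μY μZ ∧
    ∀ π' ∈ MartingaleCouplings μX μY μZ,
      ∫ p, c p.1 p.2.1 p.2.2 ∂(π : Measure (ℝ × ℝ × ℝ)) ≤
        ∫ p, c p.1 p.2.1 p.2.2 ∂(π' : Measure (ℝ × ℝ × ℝ))

end

/-! Existence is a compactness argument. All martingale couplings live in one cube, and the
constraints and the cost are weakly continuous once the coordinates are truncated
(`isCompact_martLaw`). The constraint set is nonempty because `x` can be spread over the three
points (`exists_weights`) and `μZ` splits into pieces with means `y₀, y₁, y₂` (`exists_split`).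

Uniqueness rests on the shape of minimizers. Write `p = (x, y)` and let `F` be a continuous
extension of `f`. Suppose there is mass at `(p, a)`, `(p, b)` and `(p', c)` with `a < c < b` and `F
p' < F p`. Sending `c` to `p`, and `a`, `b` in barycentric proportion to `p'`, keeps all constraints
and strictly lowers the cost, since the square is strictly convex (`MartLaw.exchange`,
`IsMinimizer.resampledLaw_eq_zero`). Every fibre charges both sides of `y₁`, so for a minimizer `z`
increases with `F p` on the left of `y₁` and decreases on the right. Neither `F p` nor `z` has
atoms, hence `z` is `l (F p)` or `r (F p)`, and `{t < F p}` is the event that `z` lies strictly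
between `l t` and `r t` (`IsMinimizer.exists_levels`).

Given two minimizers, apply this to their midpoint: both then share the same `l` and `r`. It follows
that they give each level set `{t < F}` the same mass and, by the martingale property, the same
integral of `y`. They also have the same law of `x`, the same mean of `y` given `x`, and the same
law of `y`. As `y` takes three values, their laws of `(x, y)` differ by one signed measure on the
line times a fixed vector. Let `D u` be its mass up to `u`. The level sets give `D u = D v` whenever
`F (u, y₁) = F (v, y₀)`. Since `F` decreases in both variables, such a step moves right by a
definite amount, and finitely many steps reach the end of the interval, where `D` vanishes
(`eq_zero_of_step`, `eq_of_level_eq`). So the laws of `(x, y)` agree. Given `(x, y)`, `z` has two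
possible values and a prescribed mean, which fixes its conditional law (`MartLaw.eq_of_map_fst_eq`).
-/

noncomputable section

/-! ### Martingale conditions expressed through test functions -/

/-- The conditional mean of `h` given the first coordinate, tested on functions. -/
lemma condKernel_mean_test {α Ω : Type*} [MeasurableSpace α] [MeasurableSpace Ω]
    [StandardBorelSpace Ω] [Nonempty Ω] (m : Measure (α × Ω)) [IsFiniteMeasure m]
    {h : Ω → ℝ} {k : α → ℝ}
    (hh : Integrable (fun p : α × Ω => h p.2) m) (hk : Integrable (fun p : α × Ω => k p.1) m)
    (H : ∀ᵐ a ∂m.fst, ∫ ω, h ω ∂(m.condKernel a) = k a)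
    {g : α → ℝ} (hg : Measurable g) {C : ℝ} (hC : ∀ a, |g a| ≤ C) :
    ∫ p, g p.1 * (h p.2 - k p.1) ∂m = 0 := by
  have hint : Integrable (fun p : α × Ω => h p.2 - k p.1) m := hh.sub hk
  have hint2 : Integrable (fun p : α × Ω => g p.1 * (h p.2 - k p.1)) m :=
    hint.bdd_mul (hg.comp measurable_fst).aestronglyMeasurable
      (Filter.Eventually.of_forall fun p => by simpa using hC p.1)
  rw [← Measure.integral_condKernel hint2]
  have hh' := hh
  rw [← m.disintegrate m.condKernel, Measure.integrable_compProd_iff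
    (by rw [m.disintegrate m.condKernel]; exact hh.1)] at hh'
  refine integral_eq_zero_of_ae ?_
  filter_upwards [H, hh'.1] with a ha hia
  simp only [Pi.zero_apply]
  rw [integral_const_mul, integral_sub hia (integrable_const _), ha]
  simp

/-- A locally integrable function that integrates to zero against all smooth compactly supported
functions vanishes a.e.; it is applied to the conditional mean of `h` minus `k`. Having such a small
class of tests suffice is what makes the martingale constraint closed under weak limits. -/
lemma condKernel_mean_of_test {α Ω : Type*} [NormedAddCommGroup α] [NormedSpace ℝ α]
    [FiniteDimensional ℝ α] [MeasurableSpace α] [BorelSpace α] [MeasurableSpace Ω]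
    [StandardBorelSpace Ω] [Nonempty Ω] (m : Measure (α × Ω)) [IsFiniteMeasure m]
    {h : Ω → ℝ} {k : α → ℝ}
    (hh : Integrable (fun p : α × Ω => h p.2) m) (hk : Integrable (fun p : α × Ω => k p.1) m)
    (hkm : Measurable k)
    (H : ∀ g : α → ℝ, Continuous g → HasCompactSupport g →
      ∫ p, g p.1 * (h p.2 - k p.1) ∂m = 0) :
    ∀ᵐ a ∂m.fst, ∫ ω, h ω ∂(m.condKernel a) = k a := by
  have hint : Integrable (fun p : α × Ω => h p.2 - k p.1) m := hh.sub hk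
  have hh' := hh
  rw [← m.disintegrate m.condKernel, Measure.integrable_compProd_iff
    (by rw [m.disintegrate m.condKernel]; exact hh.1)] at hh'
  have hk' : Integrable k m.fst := by
    rw [Measure.fst, integrable_map_measure hkm.aestronglyMeasurable measurable_fst.aemeasurable]
    exact hk
  have hi : Integrable (fun a => ∫ ω, h ω ∂(m.condKernel a)) m.fst :=
    hh.integral_condKernel
  have key := ae_eq_zero_of_integral_contDiff_smul_eq_zero
    (μ := m.fst) (f := fun a => ∫ ω, h ω ∂(m.condKernel a) - k a)
    (hi.sub hk').locallyIntegrable (by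
      intro g hg hgs
      have hint2 : Integrable (fun p : α × Ω => g p.1 * (h p.2 - k p.1)) m := by
        obtain ⟨C, hC⟩ := hgs.exists_bound_of_continuous hg.continuous
        exact hint.bdd_mul (hg.continuous.measurable.comp measurable_fst).aestronglyMeasurable
          (Filter.Eventually.of_forall fun p => hC p.1)
      rw [← H g hg.continuous hgs, ← Measure.integral_condKernel hint2]
      refine integral_congr_ae ?_
      filter_upwards [hh'.1] with a hia
      rw [integral_const_mul, integral_sub hia (integrable_const _)]
      simp)
  filter_upwards [key] with a ha
  linarith

/-- Laws of `((x, y), z)` with given marginals for which `x, y, z` is a martingale. -/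
structure MartLaw (μX μY μZ : Measure ℝ) (m : Measure ((ℝ × ℝ) × ℝ)) : Prop where
  prob : IsProbabilityMeasure m
  mapX : m.map (fun q => q.1.1) = μX
  mapY : m.map (fun q => q.1.2) = μY
  mapZ : m.map (fun q => q.2) = μZ
  martY : ∀ g : ℝ → ℝ, Measurable g → ∀ C, (∀ x, |g x| ≤ C) →
    ∫ q, g q.1.1 * (q.1.2 - q.1.1) ∂m = 0
  martZ : ∀ g : ℝ × ℝ → ℝ, Measurable g → ∀ C, (∀ p, |g p| ≤ C) →
    ∫ q, g q.1 * (q.2 - q.1.2) ∂m = 0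

lemma integrable_comp_of_map {Ω : Type*} [MeasurableSpace Ω] {m : Measure Ω} [IsFiniteMeasure m]
    {μ : Measure ℝ} {φ : Ω → ℝ} (hφ : Measurable φ) (hm : m.map φ = μ) {K : ℝ}
    (hK : ∀ᵐ t ∂μ, |t| ≤ K) : Integrable φ m := by
  rw [← hm] at hK
  exact Integrable.of_bound hφ.aestronglyMeasurable K
    (by simpa using ae_of_ae_map hφ.aemeasurable hK)

lemma regroup_map (π : ProbabilityMeasure (ℝ × ℝ × ℝ)) {β : Type*} [MeasurableSpace β]
    {φ : (ℝ × ℝ) × ℝ → β} (hφ : Measurable φ) :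
    (regroup π).map φ = (π : Measure (ℝ × ℝ × ℝ)).map (fun p => φ ((p.1, p.2.1), p.2.2)) := by
  rw [regroup, Measure.map_map hφ (MeasurableEquiv.measurable _)]
  rfl

lemma integral_regroup (π : ProbabilityMeasure (ℝ × ℝ × ℝ)) (φ : (ℝ × ℝ) × ℝ → ℝ) :
    ∫ q, φ q ∂(regroup π) = ∫ p, φ ((p.1, p.2.1), p.2.2) ∂(π : Measure (ℝ × ℝ × ℝ)) := by
  rw [regroup, integral_map_equiv]
  rfl

/-- Bounded supports make all coordinates integrable, so conditional means can be traded for test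
functions. From here on the problem is linear in the law and no kernel appears in the constraints.
-/
lemma mem_martingaleCouplings_iff {μX μY μZ : Measure ℝ} {K : ℝ}
    (hX : ∀ᵐ t ∂μX, |t| ≤ K) (hY : ∀ᵐ t ∂μY, |t| ≤ K) (hZ : ∀ᵐ t ∂μZ, |t| ≤ K)
    (π : ProbabilityMeasure (ℝ × ℝ × ℝ)) :
    π ∈ MartingaleCouplings μX μY μZ ↔ MartLaw μX μY μZ (regroup π) := by
  constructor
  · rintro ⟨⟨h1, h2, h3⟩, h4, h5⟩
    have ix := integrable_comp_of_map (by fun_prop) h1 hX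
    have iy := integrable_comp_of_map (by fun_prop) h2 hY
    have h2' : (regroup π).map (fun q => q.1.2) = μY := by rw [regroup_map π (by fun_prop)]; exact h2
    have h3' : (regroup π).map (fun q => q.2) = μZ := by rw [regroup_map π (by fun_prop)]; exact h3
    have iy' := integrable_comp_of_map (by fun_prop) h2' hY
    have iz' := integrable_comp_of_map (by fun_prop) h3' hZ
    refine ⟨inferInstance, by rw [regroup_map π (by fun_prop)]; exact h1, h2', h3', ?_, ?_⟩
    · intro g hg C hC
      rw [integral_regroup π (fun q => g q.1.1 * (q.1.2 - q.1.1))]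
      exact condKernel_mean_test (π : Measure (ℝ × ℝ × ℝ)) (h := fun q => q.1) (k := fun x => x)
        iy ix h4 hg hC
    · intro g hg C hC
      exact condKernel_mean_test (regroup π) (h := fun z => z) (k := fun p => p.2)
        iz' iy' h5 hg hC
  · intro H
    have h1 := H.mapX
    have h2 := H.mapY
    have h3 := H.mapZ
    have iy' := integrable_comp_of_map (by fun_prop) h2 hY
    have iz' := integrable_comp_of_map (by fun_prop) h3 hZ
    rw [regroup_map π (by fun_prop)] at h1 h2 h3
    have ix := integrable_comp_of_map (by fun_prop) h1 hX
    have iy := integrable_comp_of_map (by fun_prop) h2 hY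
    refine ⟨⟨h1, h2, h3⟩, ?_, ?_⟩
    · refine condKernel_mean_of_test (π : Measure (ℝ × ℝ × ℝ)) (h := fun q => q.1)
        (k := fun x => x) iy ix measurable_id fun g hg hgs => ?_
      obtain ⟨C, hC⟩ := hgs.exists_bound_of_continuous hg
      rw [← H.martY g hg.measurable C hC,
        integral_regroup π (fun q => g q.1.1 * (q.1.2 - q.1.1))]
    · refine condKernel_mean_of_test (regroup π) (h := fun z => z)
        (k := fun p => p.2) iz' iy' measurable_snd fun g hg hgs => ?_
      obtain ⟨C, hC⟩ := hgs.exists_bound_of_continuous hg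
      exact H.martZ g hg.measurable C hC

/-- Continuous compactly supported test functions are enough for the martingale property. -/
lemma MartLaw.of_continuous {μX μY μZ : Measure ℝ} {K : ℝ}
    (hX : ∀ᵐ t ∂μX, |t| ≤ K) (hY : ∀ᵐ t ∂μY, |t| ≤ K) (hZ : ∀ᵐ t ∂μZ, |t| ≤ K)
    {m : Measure ((ℝ × ℝ) × ℝ)} [IsProbabilityMeasure m]
    (h1 : m.map (fun q => q.1.1) = μX) (h2 : m.map (fun q => q.1.2) = μY)
    (h3 : m.map (fun q => q.2) = μZ)
    (h4 : ∀ g : ℝ → ℝ, Continuous g → HasCompactSupport g →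
      ∫ q, g q.1.1 * (q.1.2 - q.1.1) ∂m = 0)
    (h5 : ∀ g : ℝ × ℝ → ℝ, Continuous g → HasCompactSupport g →
      ∫ q, g q.1 * (q.2 - q.1.2) ∂m = 0) : MartLaw μX μY μZ m := by
  have ix := integrable_comp_of_map (by fun_prop) h1 hX
  have iy := integrable_comp_of_map (by fun_prop) h2 hY
  have iz := integrable_comp_of_map (by fun_prop) h3 hZ
  have hm : Measurable (fun q : (ℝ × ℝ) × ℝ => q.1) := by fun_prop
  refine ⟨inferInstance, h1, h2, h3, fun g hg C hC => ?_, fun g hg C hC => ?_⟩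
  -- Continuous tests determine the conditional mean a.e., and the conditional mean gives back all
  -- bounded measurable tests. For the step from `x` to `y` this is done on the law of the pair `(x,
  -- y)`.
  · have e : ∀ g : ℝ → ℝ, Measurable g → ∫ p, g p.1 * (p.2 - p.1) ∂(m.map (fun q => q.1)) =
        ∫ q, g q.1.1 * (q.1.2 - q.1.1) ∂m := fun g hg => by
      rw [integral_map hm.aemeasurable
        (Measurable.aestronglyMeasurable (by fun_prop))]
    have : IsProbabilityMeasure (m.map (fun q => q.1)) :=
      Measure.isProbabilityMeasure_map hm.aemeasurable
    have jx : Integrable (fun p : ℝ × ℝ => p.1) (m.map (fun q => q.1)) := by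
      rw [integrable_map_measure (Measurable.aestronglyMeasurable (by fun_prop)) hm.aemeasurable]
      exact ix
    have jy : Integrable (fun p : ℝ × ℝ => p.2) (m.map (fun q => q.1)) := by
      rw [integrable_map_measure (Measurable.aestronglyMeasurable (by fun_prop)) hm.aemeasurable]
      exact iy
    rw [← e g hg]
    exact condKernel_mean_test _ (h := fun y => y) (k := fun x => x) jy jx
      (condKernel_mean_of_test _ jy jx measurable_id
        fun g hg hgs => by rw [e g hg.measurable]; exact h4 g hg hgs) hg hC
  · exact condKernel_mean_test m (h := fun z => z) (k := fun p => p.2) iz iy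
      (condKernel_mean_of_test m iz iy measurable_snd h5) hg hC

/-! ### Compactness and existence of a minimizer -/

/-- Truncation of a real number to `[-K, K]`. -/
def truncate (K t : ℝ) : ℝ := max (-K) (min K t)

lemma truncate_eq {K t : ℝ} (h : |t| ≤ K) : truncate K t = t := by
  rw [truncate, min_eq_right (abs_le.1 h).2, max_eq_right (abs_le.1 h).1]

lemma abs_truncate_le {K : ℝ} (hK : 0 ≤ K) (t : ℝ) : |truncate K t| ≤ K := by
  rw [truncate, abs_le]
  exact ⟨le_max_left _ _, max_le (by linarith) (min_le_left _ _)⟩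

@[fun_prop]
lemma continuous_truncate (K : ℝ) : Continuous (truncate K) := by
  unfold truncate; fun_prop

lemma MartLaw.ae_bound {μX μY μZ : Measure ℝ} {K : ℝ}
    (hX : ∀ᵐ t ∂μX, |t| ≤ K) (hY : ∀ᵐ t ∂μY, |t| ≤ K) (hZ : ∀ᵐ t ∂μZ, |t| ≤ K)
    {m : Measure ((ℝ × ℝ) × ℝ)} (H : MartLaw μX μY μZ m) :
    ∀ᵐ q ∂m, |q.1.1| ≤ K ∧ |q.1.2| ≤ K ∧ |q.2| ≤ K := by
  rw [← H.mapX] at hX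
  rw [← H.mapY] at hY
  rw [← H.mapZ] at hZ
  filter_upwards [ae_of_ae_map (by fun_prop) hX, ae_of_ae_map (by fun_prop) hY,
    ae_of_ae_map (by fun_prop) hZ] with q h1 h2 h3
  exact ⟨h1, h2, h3⟩

lemma continuous_integral_of_bound {φ : (ℝ × ℝ) × ℝ → ℝ} (hφ : Continuous φ) {C : ℝ}
    (hC : ∀ q, |φ q| ≤ C) : Continuous fun ν : ProbabilityMeasure ((ℝ × ℝ) × ℝ) =>
      ∫ q, φ q ∂(ν : Measure ((ℝ × ℝ) × ℝ)) := by
  have := ProbabilityMeasure.continuous_integral_boundedContinuousFunction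
    (BoundedContinuousFunction.ofNormedAddCommGroup φ hφ C hC)
  simpa using this

/-- All these laws are carried by one cube, hence tight, and Prokhorov's theorem applies. The set is
closed because marginals depend continuously on the law, and the martingale conditions become
integrals of bounded continuous functions after a truncation that changes nothing on the cube. -/
lemma isCompact_martLaw {μX μY μZ : Measure ℝ} {K : ℝ} (hK : 0 ≤ K)
    (hX : ∀ᵐ t ∂μX, |t| ≤ K) (hY : ∀ᵐ t ∂μY, |t| ≤ K) (hZ : ∀ᵐ t ∂μZ, |t| ≤ K) :
    IsCompact {ν : ProbabilityMeasure ((ℝ × ℝ) × ℝ) | MartLaw μX μY μZ ν} := by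
  set S := {ν : ProbabilityMeasure ((ℝ × ℝ) × ℝ) | MartLaw μX μY μZ ν} with hS
  have htight : IsTightMeasureSet {((μ : ProbabilityMeasure ((ℝ × ℝ) × ℝ)) : Measure ((ℝ × ℝ) × ℝ)) | μ ∈ S} := by
    rw [isTightMeasureSet_iff_exists_isCompact_measure_compl_le]
    intro ε _
    refine ⟨(Icc (-K) K ×ˢ Icc (-K) K) ×ˢ Icc (-K) K,
      (isCompact_Icc.prod isCompact_Icc).prod isCompact_Icc, ?_⟩
    rintro _ ⟨μ, hμ, rfl⟩
    have := MartLaw.ae_bound hX hY hZ hμ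
    refine le_of_eq_of_le ?_ (zero_le)
    rw [← compl_mem_ae_iff, compl_compl]
    filter_upwards [this] with q hq
    simpa only [mem_prod, mem_Icc, abs_le, and_assoc] using hq
  refine (isCompact_closure_of_isTightMeasureSet htight).of_isClosed_subset ?_ subset_closure
  rcases S.eq_empty_or_nonempty with he | ⟨ν₀, hν₀⟩
  · rw [he]; exact isClosed_empty
  -- A fixed member `ν₀` stands in for the prescribed marginals, so that each marginal constraint
  -- equates a continuous map into probability measures with a constant.
  have cl : ∀ φ : (ℝ × ℝ) × ℝ → ℝ, Continuous φ →
      IsClosed {ν : ProbabilityMeasure ((ℝ × ℝ) × ℝ) |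
        (ν : Measure ((ℝ × ℝ) × ℝ)).map φ = (ν₀ : Measure ((ℝ × ℝ) × ℝ)).map φ} := fun φ hφ => by
    have : {ν : ProbabilityMeasure ((ℝ × ℝ) × ℝ) |
        (ν : Measure ((ℝ × ℝ) × ℝ)).map φ = (ν₀ : Measure ((ℝ × ℝ) × ℝ)).map φ} =
        {ν | ν.map hφ.measurable.aemeasurable = ν₀.map hφ.measurable.aemeasurable} := by
      ext ν
      simp only [mem_ofPred_eq]
      rw [← ProbabilityMeasure.toMeasure_injective.eq_iff]
      rfl
    rw [this]
    exact isClosed_eq (ProbabilityMeasure.continuous_map hφ) continuous_const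
  have cl2 : ∀ φ : (ℝ × ℝ) × ℝ → ℝ, Continuous φ → (∃ C, ∀ q, |φ q| ≤ C) →
      IsClosed {ν : ProbabilityMeasure ((ℝ × ℝ) × ℝ) | ∫ q, φ q ∂(ν : Measure ((ℝ × ℝ) × ℝ)) = 0} := by
    rintro φ hφ ⟨C, hC⟩
    exact isClosed_eq (continuous_integral_of_bound hφ hC) continuous_const
  have hbd : ∀ {α : Type} [TopologicalSpace α] {g : α → ℝ}, Continuous g → HasCompactSupport g →
      ∀ (π : (ℝ × ℝ) × ℝ → α) (u v : (ℝ × ℝ) × ℝ → ℝ),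
      ∃ C, ∀ q, |g (π q) * (truncate K (u q) - truncate K (v q))| ≤ C := by
    intro α _ g hg hgs π u v
    obtain ⟨C, hC⟩ := hgs.exists_bound_of_continuous hg
    refine ⟨C * (K + K), fun q => ?_⟩
    rw [abs_mul]
    refine mul_le_mul (hC _) ?_ (abs_nonneg _) ((norm_nonneg _).trans (hC (π q)))
    exact (abs_sub _ _).trans (add_le_add (abs_truncate_le hK _) (abs_truncate_le hK _))
  have e : S = {ν : ProbabilityMeasure ((ℝ × ℝ) × ℝ) | (ν : Measure ((ℝ × ℝ) × ℝ)).map (fun q => q.1.1) =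
        (ν₀ : Measure ((ℝ × ℝ) × ℝ)).map (fun q => q.1.1)} ∩
      ({ν : ProbabilityMeasure ((ℝ × ℝ) × ℝ) | (ν : Measure ((ℝ × ℝ) × ℝ)).map (fun q => q.1.2) =
        (ν₀ : Measure ((ℝ × ℝ) × ℝ)).map (fun q => q.1.2)} ∩
      ({ν : ProbabilityMeasure ((ℝ × ℝ) × ℝ) | (ν : Measure ((ℝ × ℝ) × ℝ)).map (fun q => q.2) =
        (ν₀ : Measure ((ℝ × ℝ) × ℝ)).map (fun q => q.2)} ∩
      ((⋂ (g : ℝ → ℝ) (_ : Continuous g) (_ : HasCompactSupport g),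
        {ν : ProbabilityMeasure ((ℝ × ℝ) × ℝ) |
          ∫ q, g q.1.1 * (truncate K q.1.2 - truncate K q.1.1) ∂(ν : Measure ((ℝ × ℝ) × ℝ)) = 0}) ∩
      (⋂ (g : ℝ × ℝ → ℝ) (_ : Continuous g) (_ : HasCompactSupport g),
        {ν : ProbabilityMeasure ((ℝ × ℝ) × ℝ) |
          ∫ q, g q.1 * (truncate K q.2 - truncate K q.1.2) ∂(ν : Measure ((ℝ × ℝ) × ℝ)) = 0})))) := by
    ext ν
    simp only [mem_inter_iff, mem_iInter, mem_ofPred_eq, hS]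
    rw [hν₀.mapX, hν₀.mapY, hν₀.mapZ]
    constructor
    · intro H
      refine ⟨H.mapX, H.mapY, H.mapZ, fun g hg hgs => ?_, fun g hg hgs => ?_⟩
      · obtain ⟨C, hC⟩ := hgs.exists_bound_of_continuous hg
        rw [← H.martY g hg.measurable C hC]
        refine integral_congr_ae ?_
        filter_upwards [H.ae_bound hX hY hZ] with q hq
        simp only [truncate_eq hq.1, truncate_eq hq.2.1]
      · obtain ⟨C, hC⟩ := hgs.exists_bound_of_continuous hg
        rw [← H.martZ g hg.measurable C hC]
        refine integral_congr_ae ?_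
        filter_upwards [H.ae_bound hX hY hZ] with q hq
        simp only [truncate_eq hq.2.2, truncate_eq hq.2.1]
    · rintro ⟨h1, h2, h3, h4, h5⟩
      have b : ∀ᵐ q ∂(ν : Measure ((ℝ × ℝ) × ℝ)), |q.1.1| ≤ K ∧ |q.1.2| ≤ K ∧ |q.2| ≤ K := by
        rw [← h1] at hX
        rw [← h2] at hY
        rw [← h3] at hZ
        filter_upwards [ae_of_ae_map (by fun_prop) hX, ae_of_ae_map (by fun_prop) hY,
          ae_of_ae_map (by fun_prop) hZ] with q h1 h2 h3
        exact ⟨h1, h2, h3⟩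
      refine MartLaw.of_continuous hX hY hZ h1 h2 h3 (fun g hg hgs => ?_) (fun g hg hgs => ?_)
      · rw [← h4 g hg hgs]
        refine integral_congr_ae ?_
        filter_upwards [b] with q hq
        simp only [truncate_eq hq.1, truncate_eq hq.2.1]
      · rw [← h5 g hg hgs]
        refine integral_congr_ae ?_
        filter_upwards [b] with q hq
        simp only [truncate_eq hq.2.2, truncate_eq hq.2.1]
  rw [e]
  refine (cl _ (by fun_prop)).inter ((cl _ (by fun_prop)).inter ((cl _ (by fun_prop)).inter
    (IsClosed.inter ?_ ?_)))
  · refine isClosed_iInter fun g => isClosed_iInter fun hg => isClosed_iInter fun hgs => ?_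
    exact cl2 _ (by fun_prop) (hbd hg hgs (fun q => q.1.1) (fun q => q.1.2) (fun q => q.1.1))
  · refine isClosed_iInter fun g => isClosed_iInter fun hg => isClosed_iInter fun hgs => ?_
    exact cl2 _ (by fun_prop) (hbd hg hgs (fun q => q.1) (fun q => q.2) (fun q => q.1.2))

/-- The martingale transport problem with continuous cost `F (x, y) z ^ 2` has a solution. -/
lemma exists_minimizer_martLaw {μX μY μZ : Measure ℝ} {K : ℝ} (hK : 0 ≤ K)
    (hX : ∀ᵐ t ∂μX, |t| ≤ K) (hY : ∀ᵐ t ∂μY, |t| ≤ K) (hZ : ∀ᵐ t ∂μZ, |t| ≤ K)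
    (hne : ∃ m, MartLaw μX μY μZ m)
    {F : ℝ × ℝ → ℝ} (hF : Continuous F) {C : ℝ} (hC : ∀ p, |F p| ≤ C) :
    ∃ m, MartLaw μX μY μZ m ∧ ∀ m', MartLaw μX μY μZ m' →
      ∫ q, F q.1 * q.2 ^ 2 ∂m ≤ ∫ q, F q.1 * q.2 ^ 2 ∂m' := by
  have hcont : Continuous fun ν : ProbabilityMeasure ((ℝ × ℝ) × ℝ) =>
      ∫ q, F q.1 * (truncate K q.2) ^ 2 ∂(ν : Measure ((ℝ × ℝ) × ℝ)) :=
    continuous_integral_of_bound (by fun_prop) (C := C * K ^ 2) fun q => by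
      rw [abs_mul, abs_pow]
      exact mul_le_mul (hC _) (pow_le_pow_left₀ (abs_nonneg _) (abs_truncate_le hK _) 2)
        (by positivity) ((abs_nonneg _).trans (hC 0))
  obtain ⟨m₀, h₀⟩ := hne
  have := h₀.prob
  obtain ⟨ν, hν, hmin⟩ := (isCompact_martLaw hK hX hY hZ).exists_isMinOn
    ⟨⟨m₀, h₀.prob⟩, h₀⟩ hcont.continuousOn
  have e : ∀ m, MartLaw μX μY μZ m → ∫ q, F q.1 * q.2 ^ 2 ∂m =
      ∫ q, F q.1 * (truncate K q.2) ^ 2 ∂m := fun m hm => by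
    refine integral_congr_ae ?_
    filter_upwards [hm.ae_bound hX hY hZ] with q hq
    simp only [truncate_eq hq.2.2]
  refine ⟨ν, hν, fun m' hm' => ?_⟩
  rw [e _ hν, e _ hm']
  exact hmin (show (⟨m', hm'.prob⟩ : ProbabilityMeasure _) ∈ _ from hm')

/-! ### Existence of a martingale coupling -/

lemma integral_threePoint {y₀ y₁ y₂ a₀ a₁ a₂ : ℝ} (ha₀ : 0 ≤ a₀) (ha₁ : 0 ≤ a₁) (ha₂ : 0 ≤ a₂)
    (φ : ℝ → ℝ) :
    ∫ t, φ t ∂(ENNReal.ofReal a₀ • Measure.dirac y₀ + ENNReal.ofReal a₁ • Measure.dirac y₁ +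
      ENNReal.ofReal a₂ • Measure.dirac y₂) = a₀ * φ y₀ + a₁ * φ y₁ + a₂ * φ y₂ := by
  have h : ∀ (a y : ℝ), Integrable φ (ENNReal.ofReal a • Measure.dirac y) := fun a y =>
    (integrable_dirac (by simp)).smul_measure ENNReal.ofReal_ne_top
  rw [integral_add_measure ((h _ _).add_measure (h _ _)) (h _ _),
    integral_add_measure (h _ _) (h _ _)]
  simp [integral_smul_measure, ha₀, ha₁, ha₂]

lemma sum_eq_one_of_threePoint {μY : Measure ℝ} [IsProbabilityMeasure μY]
    {y₀ y₁ y₂ a₀ a₁ a₂ : ℝ} (ha₀ : 0 ≤ a₀) (ha₁ : 0 ≤ a₁) (ha₂ : 0 ≤ a₂)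
    (hY : μY = ENNReal.ofReal a₀ • Measure.dirac y₀ + ENNReal.ofReal a₁ • Measure.dirac y₁ +
      ENNReal.ofReal a₂ • Measure.dirac y₂) : a₀ + a₁ + a₂ = 1 := by
  have h := integral_threePoint (y₀ := y₀) (y₁ := y₁) (y₂ := y₂) ha₀ ha₁ ha₂ (fun _ => 1)
  rw [← hY] at h
  simp at h
  linarith

lemma ConvexOrder.mean_eq {μ ν : Measure ℝ} (h : ConvexOrder μ ν) :
    ∫ t, t ∂μ = ∫ t, t ∂ν := by
  refine le_antisymm (h _ (convexOn_id convex_univ)) ?_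
  have := h (fun t => -t) (concaveOn_id convex_univ).neg
  rw [integral_neg, integral_neg] at this
  linarith

lemma convexOn_affine (a b : ℝ) : ConvexOn ℝ univ (fun x : ℝ => a * x + b) := by
  refine ⟨convex_univ, fun x _ y _ s t _ _ hst => le_of_eq ?_⟩
  simp only [smul_eq_mul]
  linear_combination (-b) * hst

/-- If `μ ⪯ ν` and the convex function `φ ≥ 0` vanishes `ν`-a.e., it vanishes `μ`-a.e. -/
lemma ConvexOrder.ae_eq_zero {μ ν : Measure ℝ} (h : ConvexOrder μ ν) {φ : ℝ → ℝ}
    (hφ : ConvexOn ℝ univ φ) (h0 : ∀ t, 0 ≤ φ t) (hi : Integrable φ μ)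
    (hν : ∫ t, φ t ∂ν = 0) : ∀ᵐ t ∂μ, φ t = 0 := by
  have h1 : ∫ t, φ t ∂μ = 0 := le_antisymm (hν ▸ h φ hφ) (integral_nonneg h0)
  exact (integral_eq_zero_iff_of_nonneg h0 hi).1 h1

/-- The law of `((x, y), z)` where `x` has law `l`, `y` is constant and `z` is independent of `x`
with law `η`. -/
def fibreLaw (l : Measure ℝ) (y : ℝ) (η : Measure ℝ) : Measure ((ℝ × ℝ) × ℝ) :=
  (l.map fun x => (x, y)).prod η

section fibreLaw

variable (l : Measure ℝ) (y : ℝ) (η : Measure ℝ) [IsProbabilityMeasure η]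

instance [IsFiniteMeasure l] : IsFiniteMeasure (fibreLaw l y η) := by unfold fibreLaw; infer_instance

lemma fibreLaw_map_fst : (fibreLaw l y η).map (fun q => q.1) = l.map fun x => (x, y) := by
  simp [fibreLaw]

lemma fibreLaw_mapX : (fibreLaw l y η).map (fun q => q.1.1) = l := by
  have : (fun q : (ℝ × ℝ) × ℝ => q.1.1) = (fun p : ℝ × ℝ => p.1) ∘ (fun q => q.1) := rfl
  rw [this, ← Measure.map_map (by fun_prop) (by fun_prop), fibreLaw_map_fst,
    Measure.map_map (by fun_prop) (by fun_prop)]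
  exact Measure.map_id

lemma fibreLaw_mapY : (fibreLaw l y η).map (fun q => q.1.2) = l univ • Measure.dirac y := by
  have : (fun q : (ℝ × ℝ) × ℝ => q.1.2) = (fun p : ℝ × ℝ => p.2) ∘ (fun q => q.1) := rfl
  rw [this, ← Measure.map_map (by fun_prop) (by fun_prop), fibreLaw_map_fst,
    Measure.map_map (by fun_prop) (by fun_prop)]
  exact Measure.map_const l y

lemma fibreLaw_mapZ : (fibreLaw l y η).map (fun q => q.2) = l univ • η := by
  have := Measure.map_snd_prod (μ := l.map fun x => (x, y)) (ν := η)
  rw [Measure.map_apply (by fun_prop) MeasurableSet.univ] at this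
  simpa [fibreLaw] using this

lemma fibreLaw_martZ [IsFiniteMeasure l] (hη : Integrable (fun z => z) η) (hm : ∫ z, z ∂η = y)
    (g : ℝ × ℝ → ℝ) :
    ∫ q, g q.1 * (q.2 - q.1.2) ∂(fibreLaw l y η) = 0 := by
  have h1 : ∫ q, g q.1 * (q.2 - q.1.2) ∂(fibreLaw l y η) =
      ∫ q, g q.1 * (q.2 - y) ∂(fibreLaw l y η) := by
    refine integral_congr_ae ?_
    have h2 : ∀ᵐ t ∂((fibreLaw l y η).map fun q => q.1.2), t = y := by
      rw [fibreLaw_mapY]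
      refine Measure.ae_smul_measure ?_ _
      simp [ae_dirac_eq]
    filter_upwards [ae_of_ae_map (by fun_prop) h2] with q hq
    rw [hq]
  rw [h1, fibreLaw, integral_prod_mul (f := g) (g := fun z => z - y),
    integral_sub hη (integrable_const _), hm]
  simp

end fibreLaw

lemma integrable_id_of_ae_bound {μ : Measure ℝ} [IsFiniteMeasure μ] {K : ℝ}
    (h : ∀ᵐ t ∂μ, |t| ≤ K) : Integrable (fun t => t) μ :=
  Integrable.of_bound (by fun_prop) K (by simpa using h)

/-- A measure on both sides of `[y₀, y₂]` splits into parts with means `y₀, y₁, y₂`. -/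
lemma exists_split {μZ : Measure ℝ} [IsProbabilityMeasure μZ]
    {K : ℝ} (hZb : ∀ᵐ t ∂μZ, |t| ≤ K)
    {y₀ y₁ y₂ zm zp : ℝ} (hy₀₁ : y₀ < y₁) (hy₁₂ : y₁ < y₂) (hzl : zm < y₀) (hzr : y₂ < zp)
    (hZ : ∀ᵐ z ∂μZ, z ≤ zm ∨ zp ≤ z)
    {a₀ a₁ a₂ : ℝ} (ha₀ : 0 < a₀) (ha₁ : 0 < a₁) (ha₂ : 0 < a₂) (ha : a₀ + a₁ + a₂ = 1)
    (hm : ∫ z, z ∂μZ = a₀ * y₀ + a₁ * y₁ + a₂ * y₂) :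
    ∃ η : ℝ → Measure ℝ, (∀ y ∈ Icc y₀ y₂, IsProbabilityMeasure (η y) ∧
      Integrable (fun z => z) (η y) ∧ ∫ z, z ∂(η y) = y) ∧
      ENNReal.ofReal a₀ • η y₀ + ENNReal.ofReal a₁ • η y₁ + ENNReal.ofReal a₂ • η y₂ = μZ := by
  set L := μZ.restrict (Iio y₁) with hL
  set U := μZ.restrict (Iio y₁)ᶜ with hR
  have hLR : L + U = μZ := Measure.restrict_add_restrict_compl measurableSet_Iio
  have hi : Integrable (fun z : ℝ => z) μZ := integrable_id_of_ae_bound hZb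
  have iL : Integrable (fun z : ℝ => z) L := hi.restrict
  have iR : Integrable (fun z : ℝ => z) U := hi.restrict
  have hLz : ∀ᵐ z ∂L, z ≤ zm := by
    rw [hL, ae_restrict_iff' measurableSet_Iio]
    filter_upwards [hZ] with z hz hz1
    rcases hz with h | h
    · exact h
    · simp only [mem_Iio] at hz1; linarith
  have hRz : ∀ᵐ z ∂U, zp ≤ z := by
    rw [hR, ae_restrict_iff' measurableSet_Iio.compl]
    filter_upwards [hZ] with z hz hz1
    rcases hz with h | h
    · simp only [mem_compl_iff, mem_Iio, not_lt] at hz1; linarith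
    · exact h
  set mL := L.real univ with hmL
  set mR := U.real univ with hmR
  set sL := ∫ z, z ∂L with hsL
  set sR := ∫ z, z ∂U with hsR
  have hm1 : mL + mR = 1 := by
    have : (L + U).real univ = 1 := by rw [hLR]; simp
    rwa [measureReal_add_apply] at this
  have hs1 : sL + sR = a₀ * y₀ + a₁ * y₁ + a₂ * y₂ := by
    rw [← hm, ← hLR, integral_add_measure iL iR]
  have hsL' : sL ≤ zm * mL := by
    have := integral_mono_ae iL (integrable_const zm) hLz
    simpa [mul_comm] using this
  have hsR' : zp * mR ≤ sR := by
    have := integral_mono_ae (integrable_const zp) iR hRz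
    simpa [mul_comm] using this
  have hmL0 : 0 ≤ mL := measureReal_nonneg
  have hmR0 : 0 ≤ mR := measureReal_nonneg
  -- The mean lies strictly between `y₀` and `y₂`, so `μZ` cannot sit on one side only: its mean
  -- would be at most `zm` or at least `zp`.
  have mean_gt : y₀ < a₀ * y₀ + a₁ * y₁ + a₂ * y₂ := by
    have e : y₀ = (a₀ + a₁ + a₂) * y₀ := by rw [ha, one_mul]
    nlinarith
  have mean_lt : a₀ * y₀ + a₁ * y₁ + a₂ * y₂ < y₂ := by
    have e : y₂ = (a₀ + a₁ + a₂) * y₂ := by rw [ha, one_mul]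
    nlinarith
  have mLpos : 0 < mL := by
    rcases hmL0.lt_or_eq with h | h
    · exact h
    · have hR1 : mR = 1 := by linarith
      rw [← h] at hsL'
      rw [hR1] at hsR'
      have : sL = 0 := by
        have : L = 0 := by
          rw [hmL, measureReal_def, eq_comm, ENNReal.toReal_eq_zero_iff] at h
          rcases h with h | h
          · exact Measure.measure_univ_eq_zero.1 h
          · exact absurd h (measure_ne_top _ _)
        rw [hsL, this]; simp
      linarith
  have mRpos : 0 < mR := by
    rcases hmR0.lt_or_eq with h | h
    · exact h
    · have hL1 : mL = 1 := by linarith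
      rw [hL1] at hsL'
      have : sR = 0 := by
        have : U = 0 := by
          rw [hmR, measureReal_def, eq_comm, ENNReal.toReal_eq_zero_iff] at h
          rcases h with h | h
          · exact Measure.measure_univ_eq_zero.1 h
          · exact absurd h (measure_ne_top _ _)
        rw [hsR, this]; simp
      linarith
  -- Determinant of the system `mL * α + mR * β = 1`, `sL * α + sR * β = y`, which says that `α • L
  -- + β • U` is a probability with mean `y`. Cramer's rule gives the two weights below.
  set D := mL * sR - mR * sL with hD
  have hDpos : 0 < D := by
    have h1 : mL * (zp * mR) ≤ mL * sR := mul_le_mul_of_nonneg_left hsR' hmL0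
    have h2 : mR * sL ≤ mR * (zm * mL) := mul_le_mul_of_nonneg_left hsL' hmR0
    have h3 : 0 < mL * mR * (zp - zm) := by
      apply mul_pos (mul_pos mLpos mRpos); linarith
    rw [hD]; linarith
  have hα : ∀ y ∈ Icc y₀ y₂, 0 ≤ (sR - mR * y) / D := fun y hy => by
    apply div_nonneg _ hDpos.le
    have : mR * y ≤ mR * zp := mul_le_mul_of_nonneg_left (by linarith [hy.2]) hmR0
    linarith
  have hβ : ∀ y ∈ Icc y₀ y₂, 0 ≤ (mL * y - sL) / D := fun y hy => by
    apply div_nonneg _ hDpos.le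
    have : mL * zm ≤ mL * y := mul_le_mul_of_nonneg_left (by linarith [hy.1]) hmL0
    linarith
  refine ⟨fun y => ENNReal.ofReal ((sR - mR * y) / D) • L + ENNReal.ofReal ((mL * y - sL) / D) • U,
    fun y hy => ?_, ?_⟩
  · have j1 := iL.smul_measure (c := ENNReal.ofReal ((sR - mR * y) / D)) ENNReal.ofReal_ne_top
    have j2 := iR.smul_measure (c := ENNReal.ofReal ((mL * y - sL) / D)) ENNReal.ofReal_ne_top
    refine ⟨⟨?_⟩, j1.add_measure j2, ?_⟩
    · have e1 : L univ = ENNReal.ofReal mL := by rw [hmL, ofReal_measureReal]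
      have e2 : U univ = ENNReal.ofReal mR := by rw [hmR, ofReal_measureReal]
      rw [Measure.add_apply, Measure.smul_apply, Measure.smul_apply, smul_eq_mul, smul_eq_mul,
        e1, e2, ← ENNReal.ofReal_mul (hα y hy), ← ENNReal.ofReal_mul (hβ y hy),
        ← ENNReal.ofReal_add (mul_nonneg (hα y hy) hmL0) (mul_nonneg (hβ y hy) hmR0),
        ENNReal.ofReal_eq_one]
      field_simp
      rw [hD]; ring
    · rw [integral_add_measure j1 j2, integral_smul_measure, integral_smul_measure,
        ENNReal.toReal_ofReal (hα y hy), ENNReal.toReal_ofReal (hβ y hy), smul_eq_mul, smul_eq_mul,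
        ← hsL, ← hsR]
      field_simp
      rw [hD]; ring
  · have m0 : y₀ ∈ Icc y₀ y₂ := ⟨le_rfl, by linarith⟩
    have m1 : y₁ ∈ Icc y₀ y₂ := ⟨hy₀₁.le, hy₁₂.le⟩
    have m2 : y₂ ∈ Icc y₀ y₂ := ⟨by linarith, le_rfl⟩
    have comb : ∀ u v w : ℝ, 0 ≤ u → 0 ≤ v → 0 ≤ w → a₀ * u + a₁ * v + a₂ * w = 1 →
        ENNReal.ofReal a₀ * ENNReal.ofReal u + ENNReal.ofReal a₁ * ENNReal.ofReal v +
          ENNReal.ofReal a₂ * ENNReal.ofReal w = 1 := by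
      intro u v w hu hv hw h
      rw [← ENNReal.ofReal_mul ha₀.le, ← ENNReal.ofReal_mul ha₁.le, ← ENNReal.ofReal_mul ha₂.le,
        ← ENNReal.ofReal_add (by positivity) (by positivity),
        ← ENNReal.ofReal_add (by positivity) (by positivity), h, ENNReal.ofReal_one]
    -- Both weights are affine in `y`, and at the mean `sL + sR` of `μZ` they equal `1`; so
    -- averaging them over `y₀, y₁, y₂` returns `L + U`.
    have c1 := comb _ _ _ (hα _ m0) (hα _ m1) (hα _ m2) (by
      field_simp
      have : D = sR - mR * (sL + sR) := by rw [hD, show mL = 1 - mR by linarith]; ring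
      rw [this, hs1]; linear_combination sR * ha)
    have c2 := comb _ _ _ (hβ _ m0) (hβ _ m1) (hβ _ m2) (by
      field_simp
      have : D = mL * (sL + sR) - sL := by rw [hD, show mR = 1 - mL by linarith]; ring
      rw [this, hs1]; linear_combination (-sL) * ha)
    calc _ = (ENNReal.ofReal a₀ * ENNReal.ofReal ((sR - mR * y₀) / D) +
            ENNReal.ofReal a₁ * ENNReal.ofReal ((sR - mR * y₁) / D) +
            ENNReal.ofReal a₂ * ENNReal.ofReal ((sR - mR * y₂) / D)) • L +
          (ENNReal.ofReal a₀ * ENNReal.ofReal ((mL * y₀ - sL) / D) +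
            ENNReal.ofReal a₁ * ENNReal.ofReal ((mL * y₁ - sL) / D) +
            ENNReal.ofReal a₂ * ENNReal.ofReal ((mL * y₂ - sL) / D)) • U := by
          simp only [smul_add, add_smul, mul_smul]
          abel
      _ = μZ := by rw [c1, c2, one_smul, one_smul, hLR]

/-- A measure below a three-point measure in convex order disintegrates along the three points. -/
lemma exists_weights {μX μY : Measure ℝ} [IsProbabilityMeasure μX] [IsProbabilityMeasure μY]
    (hXY : ConvexOrder μX μY) {K : ℝ} (hXb : ∀ᵐ t ∂μX, |t| ≤ K)
    {y₀ y₁ y₂ : ℝ} (hy₀₁ : y₀ < y₁) (hy₁₂ : y₁ < y₂)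
    {a₀ a₁ a₂ : ℝ} (ha₀ : 0 < a₀) (ha₁ : 0 < a₁) (ha₂ : 0 < a₂)
    (hY : μY = ENNReal.ofReal a₀ • Measure.dirac y₀ + ENNReal.ofReal a₁ • Measure.dirac y₁ +
      ENNReal.ofReal a₂ • Measure.dirac y₂) :
    ∃ p₀ p₁ p₂ : ℝ → ℝ, Measurable p₀ ∧ Measurable p₁ ∧ Measurable p₂ ∧
      (∀ᵐ x ∂μX, 0 ≤ p₀ x ∧ 0 ≤ p₁ x ∧ 0 ≤ p₂ x) ∧
      (∀ x, p₀ x + p₁ x + p₂ x = 1) ∧ (∀ x, p₀ x * y₀ + p₁ x * y₁ + p₂ x * y₂ = x) ∧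
      Integrable p₀ μX ∧ Integrable p₁ μX ∧ Integrable p₂ μX ∧
      ∫ x, p₀ x ∂μX = a₀ ∧ ∫ x, p₁ x ∂μX = a₁ ∧ ∫ x, p₂ x ∂μX = a₂ := by
  have hi : Integrable (fun x : ℝ => x) μX := integrable_id_of_ae_bound hXb
  have ha := sum_eq_one_of_threePoint ha₀.le ha₁.le ha₂.le hY
  have iY : ∀ φ : ℝ → ℝ, ∫ t, φ t ∂μY = a₀ * φ y₀ + a₁ * φ y₁ + a₂ * φ y₂ := fun φ => by
    rw [hY]; exact integral_threePoint ha₀.le ha₁.le ha₂.le φ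
  have hmean : ∫ x, x ∂μX = a₀ * y₀ + a₁ * y₁ + a₂ * y₂ := by
    rw [hXY.mean_eq, iY]
  -- Convex order tested on the positive part of `y₀ - x`, which vanishes at the three atoms.
  have hlow : ∀ᵐ x ∂μX, y₀ ≤ x := by
    have h := hXY.ae_eq_zero (φ := fun x => max (-1 * x + y₀) (0 * x + 0))
      ((convexOn_affine (-1) y₀).sup (convexOn_affine 0 0)) (fun t => by simp)
      (Integrable.sup ((hi.const_mul _).add (integrable_const _))
        ((hi.const_mul _).add (integrable_const _)))
      (by rw [iY, max_eq_right, max_eq_right, max_eq_right] <;> linarith)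
    filter_upwards [h] with x hx
    have := le_max_left (-1 * x + y₀) (0 * x + 0)
    linarith
  have hupp : ∀ᵐ x ∂μX, x ≤ y₂ := by
    have h := hXY.ae_eq_zero (φ := fun x => max (1 * x + (-y₂)) (0 * x + 0))
      ((convexOn_affine 1 (-y₂)).sup (convexOn_affine 0 0)) (fun t => by simp)
      (Integrable.sup ((hi.const_mul _).add (integrable_const _))
        ((hi.const_mul _).add (integrable_const _)))
      (by rw [iY, max_eq_right, max_eq_right, max_eq_right] <;> linarith)
    filter_upwards [h] with x hx
    have := le_max_left (1 * x + (-y₂)) (0 * x + 0)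
    linarith
  have d1 : 0 < y₁ - y₀ := by linarith
  have d2 : 0 < y₂ - y₁ := by linarith
  have d3 : 0 < y₂ - y₀ := by linarith
  -- `-q` is the tent function with value `1` at `y₁` and `0` at `y₀, y₂`. On `[y₀, y₂]` it is the
  -- largest weight that `y₁` can carry in a probability on the three points with mean `x`.
  set q : ℝ → ℝ := fun x => max (-(1 / (y₁ - y₀)) * x + y₀ / (y₁ - y₀))
    (1 / (y₂ - y₁) * x + (-y₂) / (y₂ - y₁)) with hq
  have iq : Integrable q μX := Integrable.sup ((hi.const_mul _).add (integrable_const _))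
        ((hi.const_mul _).add (integrable_const _))
  have hq0 : ∀ᵐ x ∂μX, q x ≤ 0 ∧ -q x * (y₂ - y₁) ≤ y₂ - x ∧ -q x * (y₁ - y₀) ≤ x - y₀ := by
    filter_upwards [hlow, hupp] with x h1 h2
    have e1 : -(1 / (y₁ - y₀)) * x + y₀ / (y₁ - y₀) = -((x - y₀) / (y₁ - y₀)) := by
      field_simp; ring
    have e2 : 1 / (y₂ - y₁) * x + (-y₂) / (y₂ - y₁) = -((y₂ - x) / (y₂ - y₁)) := by
      field_simp; ring
    simp only [hq, e1, e2]
    refine ⟨max_le ?_ ?_, ?_, ?_⟩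
    · have : 0 ≤ (x - y₀) / (y₁ - y₀) := div_nonneg (by linarith) d1.le
      linarith
    · have : 0 ≤ (y₂ - x) / (y₂ - y₁) := div_nonneg (by linarith) d2.le
      linarith
    · rw [← le_div_iff₀ d2]
      linarith [le_max_right (-((x - y₀) / (y₁ - y₀))) (-((y₂ - x) / (y₂ - y₁)))]
    · rw [← le_div_iff₀ d1]
      linarith [le_max_left (-((x - y₀) / (y₁ - y₀))) (-((y₂ - x) / (y₂ - y₁)))]
  have hqc : ∫ x, q x ∂μX ≤ -a₁ := by
    have h := hXY q ((convexOn_affine _ _).sup (convexOn_affine _ _))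
    rw [iY] at h
    have q0 : q y₀ = 0 := by
      simp only [hq]
      rw [max_eq_left]
      · field_simp; ring
      · rw [show -(1 / (y₁ - y₀)) * y₀ + y₀ / (y₁ - y₀) = 0 by field_simp; ring,
          show 1 / (y₂ - y₁) * y₀ + (-y₂) / (y₂ - y₁) = -((y₂ - y₀) / (y₂ - y₁)) by
            field_simp; ring]
        have : 0 ≤ (y₂ - y₀) / (y₂ - y₁) := div_nonneg d3.le d2.le
        linarith
    have q1 : q y₁ = -1 := by
      simp only [hq]
      rw [show -(1 / (y₁ - y₀)) * y₁ + y₀ / (y₁ - y₀) = -1 by field_simp; ring,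
        show 1 / (y₂ - y₁) * y₁ + (-y₂) / (y₂ - y₁) = -1 by field_simp; ring]
      exact max_self _
    have q2 : q y₂ = 0 := by
      simp only [hq]
      rw [max_eq_right]
      · field_simp; ring
      · rw [show 1 / (y₂ - y₁) * y₂ + (-y₂) / (y₂ - y₁) = 0 by field_simp; ring,
          show -(1 / (y₁ - y₀)) * y₂ + y₀ / (y₁ - y₀) = -((y₂ - y₀) / (y₁ - y₀)) by
            field_simp; ring]
        have : 0 ≤ (y₂ - y₀) / (y₁ - y₀) := div_nonneg d3.le d1.le
        linarith
    rw [q0, q1, q2] at h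
    linarith
  -- Convex order tested on `q` says that the tent has `μX`-integral at least `a₁`, so scaling it by
  -- `θ ≤ 1` gives a weight with integral exactly `a₁` that is still admissible.
  set S := -∫ x, q x ∂μX with hS
  have hSpos : 0 < S := by linarith
  set θ := a₁ / S with hθ
  have hθ0 : 0 ≤ θ := by positivity
  have hθ1 : θ ≤ 1 := (div_le_one hSpos).2 (by linarith)
  set p₁ : ℝ → ℝ := fun x => θ * (-q x) with hp1
  have mq : Measurable q := by fun_prop
  have ip1 : Integrable p₁ μX := iq.neg.const_mul _
  have Ip1 : ∫ x, p₁ x ∂μX = a₁ := by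
    simp only [hp1]
    rw [integral_const_mul, integral_neg, ← hS, hθ]
    field_simp
  have aff : ∀ a b c : ℝ, ∫ x, (a + b * x + c * p₁ x) ∂μX =
      a + b * (a₀ * y₀ + a₁ * y₁ + a₂ * y₂) + c * a₁ := fun a b c => by
    have h1 : Integrable (fun x => a + b * x) μX := (integrable_const a).add (hi.const_mul b)
    rw [integral_add h1 (ip1.const_mul c), integral_add (integrable_const a) (hi.const_mul b),
      integral_const_mul, integral_const_mul,
      Ip1, hmean]
    simp
  have ip0 : Integrable (fun x => ((1 - p₁ x) * y₂ - (x - y₁ * p₁ x)) / (y₂ - y₀)) μX :=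
    ((((integrable_const _).sub ip1).mul_const _).sub (hi.sub (ip1.const_mul _))).div_const _
  have ip2 : Integrable (fun x => ((x - y₁ * p₁ x) - (1 - p₁ x) * y₀) / (y₂ - y₀)) μX :=
    ((hi.sub (ip1.const_mul _)).sub (((integrable_const _).sub ip1).mul_const _)).div_const _
  -- Total mass `1` and mean `x` determine the other two weights from `p₁`, and the mean of `μX`
  -- then forces their integrals.
  refine ⟨fun x => ((1 - p₁ x) * y₂ - (x - y₁ * p₁ x)) / (y₂ - y₀), p₁,
    fun x => ((x - y₁ * p₁ x) - (1 - p₁ x) * y₀) / (y₂ - y₀), by fun_prop, by fun_prop,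
    by fun_prop, ?_, ?_, ?_, ip0, ip1, ip2, ?_, Ip1, ?_⟩
  · filter_upwards [hq0] with x hx
    obtain ⟨h1, h2, h3⟩ := hx
    have hle : p₁ x ≤ -q x := by
      have := mul_le_mul_of_nonneg_right hθ1 (show 0 ≤ -q x by linarith)
      rwa [one_mul] at this
    refine ⟨div_nonneg ?_ d3.le, mul_nonneg hθ0 (by linarith), div_nonneg ?_ d3.le⟩
    · have := mul_le_mul_of_nonneg_right hle d2.le
      linarith
    · have := mul_le_mul_of_nonneg_right hle d1.le
      linarith
  · intro x
    field_simp
    ring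
  · intro x
    field_simp
    ring
  · rw [show (fun x => ((1 - p₁ x) * y₂ - (x - y₁ * p₁ x)) / (y₂ - y₀)) = fun x =>
      (y₂ + (-1) * x + (y₁ - y₂) * p₁ x) / (y₂ - y₀) by funext x; ring, integral_div, aff]
    field_simp
    linear_combination (-y₂) * ha
  · rw [show (fun x => ((x - y₁ * p₁ x) - (1 - p₁ x) * y₀) / (y₂ - y₀)) = fun x =>
      (-y₀ + 1 * x + (y₀ - y₁) * p₁ x) / (y₂ - y₀) by funext x; ring, integral_div, aff]
    field_simp
    linear_combination y₀ * ha

/-- Existence of a martingale coupling. -/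
lemma exists_martLaw {μX μY μZ : Measure ℝ} [IsProbabilityMeasure μX] [IsProbabilityMeasure μY]
    [IsProbabilityMeasure μZ] (hXY : ConvexOrder μX μY) (hYZ : ConvexOrder μY μZ) {K : ℝ}
    (hXb : ∀ᵐ t ∂μX, |t| ≤ K) (hZb : ∀ᵐ t ∂μZ, |t| ≤ K)
    {y₀ y₁ y₂ zm zp : ℝ} (hy₀₁ : y₀ < y₁) (hy₁₂ : y₁ < y₂) (hzl : zm < y₀) (hzr : y₂ < zp)
    (hZ : ∀ᵐ z ∂μZ, z ≤ zm ∨ zp ≤ z)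
    {a₀ a₁ a₂ : ℝ} (ha₀ : 0 < a₀) (ha₁ : 0 < a₁) (ha₂ : 0 < a₂)
    (hY : μY = ENNReal.ofReal a₀ • Measure.dirac y₀ + ENNReal.ofReal a₁ • Measure.dirac y₁ +
      ENNReal.ofReal a₂ • Measure.dirac y₂) :
    ∃ m, MartLaw μX μY μZ m := by
  have ha := sum_eq_one_of_threePoint ha₀.le ha₁.le ha₂.le hY
  have hi : Integrable (fun x : ℝ => x) μX := integrable_id_of_ae_bound hXb
  obtain ⟨p₀, p₁, p₂, mp₀, mp₁, mp₂, hp, hsum, hmean, ip₀, ip₁, ip₂, Ip₀, Ip₁, Ip₂⟩ :=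
    exists_weights hXY hXb hy₀₁ hy₁₂ ha₀ ha₁ ha₂ hY
  obtain ⟨η, hη, hηsum⟩ := exists_split hZb hy₀₁ hy₁₂ hzl hzr hZ ha₀ ha₁ ha₂ ha
    (by rw [← hYZ.mean_eq, hY]; exact integral_threePoint ha₀.le ha₁.le ha₂.le _)
  obtain ⟨e₀, j₀, k₀⟩ := hη y₀ ⟨le_rfl, by linarith⟩
  obtain ⟨e₁, j₁, k₁⟩ := hη y₁ ⟨hy₀₁.le, hy₁₂.le⟩
  obtain ⟨e₂, j₂, k₂⟩ := hη y₂ ⟨by linarith, le_rfl⟩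
  have hl : ∀ (p : ℝ → ℝ) (a : ℝ), (∀ᵐ x ∂μX, 0 ≤ p x) → Integrable p μX → ∫ x, p x ∂μX = a →
      (μX.withDensity fun x => ENNReal.ofReal (p x)) univ = ENNReal.ofReal a := by
    intro p a h0 hip hIp
    rw [withDensity_apply _ MeasurableSet.univ, Measure.restrict_univ,
      ← ofReal_integral_eq_lintegral_ofReal hip h0, hIp]
  have q₀ := hl p₀ a₀ (hp.mono fun x h => h.1) ip₀ Ip₀
  have q₁ := hl p₁ a₁ (hp.mono fun x h => h.2.1) ip₁ Ip₁
  have q₂ := hl p₂ a₂ (hp.mono fun x h => h.2.2) ip₂ Ip₂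
  set l₀ := μX.withDensity fun x => ENNReal.ofReal (p₀ x) with hl₀
  set l₁ := μX.withDensity fun x => ENNReal.ofReal (p₁ x) with hl₁
  set l₂ := μX.withDensity fun x => ENNReal.ofReal (p₂ x) with hl₂
  have f₀ : IsFiniteMeasure l₀ := ⟨by rw [q₀]; exact ENNReal.ofReal_lt_top⟩
  have f₁ : IsFiniteMeasure l₁ := ⟨by rw [q₁]; exact ENNReal.ofReal_lt_top⟩
  have f₂ : IsFiniteMeasure l₂ := ⟨by rw [q₂]; exact ENNReal.ofReal_lt_top⟩
  -- Given `x`, the value `yᵢ` is chosen with probability `pᵢ x`; given `yᵢ`, `z` has law `η yᵢ`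
  -- whatever `x` is.
  set m := fibreLaw l₀ y₀ (η y₀) + fibreLaw l₁ y₁ (η y₁) + fibreLaw l₂ y₂ (η y₂) with hm
  have mapm : ∀ φ : (ℝ × ℝ) × ℝ → ℝ, Measurable φ → m.map φ = (fibreLaw l₀ y₀ (η y₀)).map φ +
      (fibreLaw l₁ y₁ (η y₁)).map φ + (fibreLaw l₂ y₂ (η y₂)).map φ := fun φ hφ => by
    rw [hm, Measure.map_add _ _ hφ, Measure.map_add _ _ hφ]
  have hX' : m.map (fun q => q.1.1) = μX := by
    rw [mapm _ (by fun_prop), fibreLaw_mapX, fibreLaw_mapX, fibreLaw_mapX, hl₀, hl₁, hl₂,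
      ← withDensity_add_left (by fun_prop), ← withDensity_add_left (by fun_prop)]
    conv_rhs => rw [← withDensity_one (μ := μX)]
    refine withDensity_congr_ae ?_
    filter_upwards [hp] with x hx
    simp only [Pi.add_apply, Pi.one_apply]
    rw [← ENNReal.ofReal_add hx.1 hx.2.1, ← ENNReal.ofReal_add (by linarith) hx.2.2, hsum,
      ENNReal.ofReal_one]
  have hY' : m.map (fun q => q.1.2) = μY := by
    rw [mapm _ (by fun_prop), fibreLaw_mapY, fibreLaw_mapY, fibreLaw_mapY, q₀, q₁, q₂, hY]
  have hZ' : m.map (fun q => q.2) = μZ := by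
    rw [mapm _ (by fun_prop), fibreLaw_mapZ, fibreLaw_mapZ, fibreLaw_mapZ, q₀, q₁, q₂, hηsum]
  have pm : IsProbabilityMeasure m := by
    refine ⟨?_⟩
    have : μX univ = 1 := measure_univ
    rw [← hX', Measure.map_apply (by fun_prop) MeasurableSet.univ] at this
    simpa using this
  have ix : Integrable (fun q : (ℝ × ℝ) × ℝ => q.1.1) m :=
    integrable_comp_of_map (by fun_prop) hX' hXb
  have iy : Integrable (fun q : (ℝ × ℝ) × ℝ => q.1.2) m := by
    have : Integrable (fun t : ℝ => t) (m.map (fun q => q.1.2)) := by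
      rw [hY', hY]
      have h : ∀ (a y : ℝ), Integrable (fun t : ℝ => t) (ENNReal.ofReal a • Measure.dirac y) :=
        fun a y => (integrable_dirac (by simp)).smul_measure ENNReal.ofReal_ne_top
      exact ((h _ _).add_measure (h _ _)).add_measure (h _ _)
    exact this.comp_measurable (by fun_prop)
  have iz : Integrable (fun q : (ℝ × ℝ) × ℝ => q.2) m :=
    integrable_comp_of_map (by fun_prop) hZ' hZb
  refine ⟨m, pm, hX', hY', hZ', fun g hg C hC => ?_, fun g hg C hC => ?_⟩
  · have int : Integrable (fun q : (ℝ × ℝ) × ℝ => g q.1.1 * (q.1.2 - q.1.1)) m :=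
      (iy.sub ix).bdd_mul (Measurable.aestronglyMeasurable (by fun_prop))
        (Filter.Eventually.of_forall fun q => hC q.1.1)
    have i₀ := int.mono_measure (show fibreLaw l₀ y₀ (η y₀) ≤ m from
      (Measure.le_add_right (Measure.le_add_right le_rfl)))
    have i₁ := int.mono_measure (show fibreLaw l₁ y₁ (η y₁) ≤ m from
      (Measure.le_add_right (Measure.le_add_left le_rfl)))
    have i₂ := int.mono_measure (show fibreLaw l₂ y₂ (η y₂) ≤ m from
      (Measure.le_add_left le_rfl))
    have key : ∀ (p : ℝ → ℝ) (y : ℝ), Measurable p → (∀ᵐ x ∂μX, 0 ≤ p x) →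
        ∀ [IsProbabilityMeasure (η y)],
        ∫ q, g q.1.1 * (q.1.2 - q.1.1)
          ∂(fibreLaw (μX.withDensity fun x => ENNReal.ofReal (p x)) y (η y)) =
        ∫ x, p x * (g x * (y - x)) ∂μX := by
      intro p y mp hp0 _
      have h1 : ∫ q, g q.1.1 * (q.1.2 - q.1.1)
          ∂(fibreLaw (μX.withDensity fun x => ENNReal.ofReal (p x)) y (η y)) =
          ∫ p', g p'.1 * (p'.2 - p'.1)
            ∂((fibreLaw (μX.withDensity fun x => ENNReal.ofReal (p x)) y (η y)).map
              fun q => q.1) := by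
        rw [integral_map (by fun_prop) (Measurable.aestronglyMeasurable (by fun_prop))]
      rw [h1, fibreLaw_map_fst, integral_map (by fun_prop)
        (Measurable.aestronglyMeasurable (by fun_prop)),
        integral_withDensity_eq_integral_toReal_smul (by fun_prop) (by simp)]
      refine integral_congr_ae ?_
      filter_upwards [hp0] with x hx
      rw [ENNReal.toReal_ofReal hx, smul_eq_mul]
    have ig : ∀ (p : ℝ → ℝ) (y : ℝ), Measurable p → (∀ᵐ x ∂μX, 0 ≤ p x ∧ p x ≤ 1) →
        Integrable (fun x => p x * (g x * (y - x))) μX := by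
      intro p y mp hp0
      refine (((integrable_const y).sub hi).bdd_mul hg.aestronglyMeasurable
        (Filter.Eventually.of_forall hC)).bdd_mul (c := 1) mp.aestronglyMeasurable ?_
      filter_upwards [hp0] with x hx
      rw [Real.norm_eq_abs, abs_of_nonneg hx.1]
      exact hx.2
    rw [hm, integral_add_measure (i₀.add_measure i₁) i₂, integral_add_measure i₀ i₁,
      key p₀ y₀ mp₀ (hp.mono fun x h => h.1), key p₁ y₁ mp₁ (hp.mono fun x h => h.2.1),
      key p₂ y₂ mp₂ (hp.mono fun x h => h.2.2)]
    have g₀ := ig p₀ y₀ mp₀ (hp.mono fun x h => ⟨h.1, by linarith [hsum x]⟩)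
    have g₁ := ig p₁ y₁ mp₁ (hp.mono fun x h => ⟨h.2.1, by linarith [hsum x]⟩)
    have g₂ := ig p₂ y₂ mp₂ (hp.mono fun x h => ⟨h.2.2, by linarith [hsum x]⟩)
    have g₀₁ : Integrable (fun x => p₀ x * (g x * (y₀ - x)) + p₁ x * (g x * (y₁ - x))) μX :=
      g₀.add g₁
    rw [← integral_add g₀ g₁, ← integral_add g₀₁ g₂]
    refine integral_eq_zero_of_ae (Filter.Eventually.of_forall fun x => ?_)
    simp only [Pi.zero_apply]
    linear_combination g x * hmean x - g x * x * hsum x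
  · have int : Integrable (fun q : (ℝ × ℝ) × ℝ => g q.1 * (q.2 - q.1.2)) m :=
      (iz.sub iy).bdd_mul (Measurable.aestronglyMeasurable (by fun_prop))
        (Filter.Eventually.of_forall fun q => hC q.1)
    have i₀ := int.mono_measure (show fibreLaw l₀ y₀ (η y₀) ≤ m from
      (Measure.le_add_right (Measure.le_add_right le_rfl)))
    have i₁ := int.mono_measure (show fibreLaw l₁ y₁ (η y₁) ≤ m from
      (Measure.le_add_right (Measure.le_add_left le_rfl)))
    have i₂ := int.mono_measure (show fibreLaw l₂ y₂ (η y₂) ≤ m from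
      (Measure.le_add_left le_rfl))
    rw [hm, integral_add_measure (i₀.add_measure i₁) i₂, integral_add_measure i₀ i₁,
      fibreLaw_martZ _ _ _ j₀ k₀, fibreLaw_martZ _ _ _ j₁ k₁, fibreLaw_martZ _ _ _ j₂ k₂]
    simp

/-! ### Exchanging mass between fibres -/

/-- The image under `φ` of the measure with density `w` with respect to `Θ`. -/
def weightedMap {Ω β : Type*} [MeasurableSpace Ω] [MeasurableSpace β] (Θ : Measure Ω)
    (w : Ω → ℝ) (φ : Ω → β) : Measure β :=
  (Θ.withDensity fun ω => ENNReal.ofReal (w ω)).map φ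

section weightedMap

variable {Ω β γ : Type*} [MeasurableSpace Ω] [MeasurableSpace β] [MeasurableSpace γ]
  {Θ : Measure Ω} {w v : Ω → ℝ} {φ : Ω → β}

lemma weightedMap_map (hφ : Measurable φ) {ψ : β → γ} (hψ : Measurable ψ) :
    (weightedMap Θ w φ).map ψ = weightedMap Θ w (fun ω => ψ (φ ω)) := by
  rw [weightedMap, Measure.map_map hψ hφ]; rfl

lemma weightedMap_add (hw : Measurable w) (w0 : ∀ ω, 0 ≤ w ω) (v0 : ∀ ω, 0 ≤ v ω)
    (hφ : Measurable φ) :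
    weightedMap Θ (fun ω => w ω + v ω) φ = weightedMap Θ w φ + weightedMap Θ v φ := by
  rw [weightedMap, weightedMap, weightedMap, ← Measure.map_add _ _ hφ,
    ← withDensity_add_left (by fun_prop)]
  congr 2
  funext ω
  exact ENNReal.ofReal_add (w0 ω) (v0 ω)

lemma weightedMap_le {C : ℝ} (hC : ∀ ω, w ω ≤ C) (hφ : Measurable φ) :
    weightedMap Θ w φ ≤ ENNReal.ofReal C • Θ.map φ := by
  rw [weightedMap, ← Measure.map_smul, ← withDensity_const]
  exact Measure.map_mono (withDensity_mono (Filter.Eventually.of_forall fun ω =>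
    ENNReal.ofReal_le_ofReal (hC ω))) hφ

lemma integrable_weightedMap_iff (hw : Measurable w) (w0 : ∀ ω, 0 ≤ w ω) (hφ : Measurable φ)
    {G : β → ℝ} (hG : Measurable G) :
    Integrable G (weightedMap Θ w φ) ↔ Integrable (fun ω => w ω * G (φ ω)) Θ := by
  rw [weightedMap, integrable_map_measure hG.aestronglyMeasurable hφ.aemeasurable,
    integrable_withDensity_iff_integrable_smul' (by fun_prop) (by simp)]
  simp [ENNReal.toReal_ofReal (w0 _)]

lemma integral_weightedMap (hw : Measurable w) (w0 : ∀ ω, 0 ≤ w ω) (hφ : Measurable φ)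
    {G : β → ℝ} (hG : Measurable G) :
    ∫ x, G x ∂(weightedMap Θ w φ) = ∫ ω, w ω * G (φ ω) ∂Θ := by
  rw [weightedMap, integral_map hφ.aemeasurable hG.aestronglyMeasurable,
    integral_withDensity_eq_integral_toReal_smul (by fun_prop) (by simp)]
  simp [ENNReal.toReal_ofReal (w0 _)]

end weightedMap

/-- Exchange of mass between `(p, a), (p, b), (p', c)` and `(p, c), (p', a), (p', b)`, where `c` is
the barycentre of `a` and `b` with weights `u` and `v`. -/
lemma MartLaw.exchange {μX μY μZ : Measure ℝ} {K : ℝ}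
    (hX : ∀ᵐ t ∂μX, |t| ≤ K) (hY : ∀ᵐ t ∂μY, |t| ≤ K) (hZ : ∀ᵐ t ∂μZ, |t| ≤ K)
    {m : Measure ((ℝ × ℝ) × ℝ)} (H : MartLaw μX μY μZ m)
    {Ω : Type*} [MeasurableSpace Ω] {Θ : Measure Ω}
    {p p' : Ω → ℝ × ℝ} {a b c u v : Ω → ℝ} (hp : Measurable p) (hp' : Measurable p')
    (ha : Measurable a) (hb : Measurable b) (hc : Measurable c) (hu : Measurable u)
    (hv : Measurable v) (u0 : ∀ ω, 0 ≤ u ω) (v0 : ∀ ω, 0 ≤ v ω) {C : ℝ} (hC : 0 < C)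
    (huv : ∀ ω, u ω + v ω ≤ C)
    (hbar : ∀ ω, u ω * a ω + v ω * b ω = (u ω + v ω) * c ω)
    (hma : Θ.map (fun ω => (p ω, a ω)) = m) (hmb : Θ.map (fun ω => (p ω, b ω)) = m)
    (hmc : Θ.map (fun ω => (p' ω, c ω)) = m)
    {F : ℝ × ℝ → ℝ} (hF : Measurable F) {B : ℝ} (hB : ∀ p, |F p| ≤ B) :
    ∃ m', MartLaw μX μY μZ m' ∧ ∃ ε > 0, ∃ Δ : Ω → ℝ,
      (∀ ω, Δ ω = (F (p ω) - F (p' ω)) *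
        (u ω * a ω ^ 2 + v ω * b ω ^ 2 - (u ω + v ω) * c ω ^ 2)) ∧ Integrable Δ Θ ∧
      ∫ q, F q.1 * q.2 ^ 2 ∂m' = ∫ q, F q.1 * q.2 ^ 2 ∂m - ε * ∫ ω, Δ ω ∂Θ := by
  have hprob := H.prob
  set w : Ω → ℝ := fun ω => u ω + v ω with hw
  have mw : Measurable w := by fun_prop
  have w0 : ∀ ω, 0 ≤ w ω := fun ω => add_nonneg (u0 ω) (v0 ω)
  -- `r` is the mass to be removed and `s` the mass to be added. The three hypotheses on images of
  -- `Θ` bound `r` by a multiple of `m`, which makes the removal possible.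
  set r₁ := weightedMap Θ u (fun ω => (p ω, a ω)) with hr₁
  set r₂ := weightedMap Θ v (fun ω => (p ω, b ω)) with hr₂
  set r₃ := weightedMap Θ w (fun ω => (p' ω, c ω)) with hr₃
  set s₁ := weightedMap Θ u (fun ω => (p' ω, a ω)) with hs₁
  set s₂ := weightedMap Θ v (fun ω => (p' ω, b ω)) with hs₂
  set s₃ := weightedMap Θ w (fun ω => (p ω, c ω)) with hs₃
  set r := r₁ + r₂ + r₃ with hr
  set s := s₁ + s₂ + s₃ with hs
  have hrle : r ≤ ENNReal.ofReal (3 * C) • m := by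
    have l1 : r₁ ≤ ENNReal.ofReal C • m := by
      rw [← hma]; exact weightedMap_le (fun ω => by linarith [huv ω, v0 ω]) (by fun_prop)
    have l2 : r₂ ≤ ENNReal.ofReal C • m := by
      rw [← hmb]; exact weightedMap_le (fun ω => by linarith [huv ω, u0 ω]) (by fun_prop)
    have l3 : r₃ ≤ ENNReal.ofReal C • m := by
      rw [← hmc]; exact weightedMap_le huv (by fun_prop)
    have : ENNReal.ofReal (3 * C) • m =
        ENNReal.ofReal C • m + ENNReal.ofReal C • m + ENNReal.ofReal C • m := by
      rw [show 3 * C = C + C + C by ring, ENNReal.ofReal_add (by positivity) hC.le,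
        ENNReal.ofReal_add hC.le hC.le, add_smul, add_smul]
    rw [this]
    exact add_le_add (add_le_add l1 l2) l3
  -- The point `p` loses `u + v` and regains `w`, and `p'` does the opposite; the values of `z`
  -- carry the same weights before and after. So neither the law of `(x, y)` nor that of `z`
  -- changes.
  have hfst : s.map (fun q => q.1) = r.map (fun q => q.1) := by
    have m1 : Measurable (fun q : (ℝ × ℝ) × ℝ => q.1) := by fun_prop
    rw [hs, hr, Measure.map_add _ _ m1, Measure.map_add _ _ m1, Measure.map_add _ _ m1,
      Measure.map_add _ _ m1, weightedMap_map (by fun_prop) m1, weightedMap_map (by fun_prop) m1,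
      weightedMap_map (by fun_prop) m1, weightedMap_map (by fun_prop) m1,
      weightedMap_map (by fun_prop) m1, weightedMap_map (by fun_prop) m1,
      ← weightedMap_add hu u0 v0 (by fun_prop), ← weightedMap_add hu u0 v0 (by fun_prop), add_comm]
  have hsnd : s.map (fun q => q.2) = r.map (fun q => q.2) := by
    have m1 : Measurable (fun q : (ℝ × ℝ) × ℝ => q.2) := by fun_prop
    rw [hs, hr, Measure.map_add _ _ m1, Measure.map_add _ _ m1, Measure.map_add _ _ m1,
      Measure.map_add _ _ m1, weightedMap_map (by fun_prop) m1, weightedMap_map (by fun_prop) m1,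
      weightedMap_map (by fun_prop) m1, weightedMap_map (by fun_prop) m1,
      weightedMap_map (by fun_prop) m1, weightedMap_map (by fun_prop) m1]
  -- Each of the three removed pieces is at most `C` times `m`, so after scaling by `e` the
  -- subtraction leaves a positive measure.
  set e := (ENNReal.ofReal (3 * C))⁻¹ with he
  have ne0 : ENNReal.ofReal (3 * C) ≠ 0 := by
    rw [Ne, ENNReal.ofReal_eq_zero, not_le]; positivity
  have e0 : e ≠ 0 := ENNReal.inv_ne_zero.2 ENNReal.ofReal_ne_top
  have etop : e ≠ ⊤ := ENNReal.inv_ne_top.2 ne0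
  have erle : e • r ≤ m := by
    calc e • r ≤ e • (ENNReal.ofReal (3 * C) • m) := by gcongr
      _ = m := by rw [smul_smul, he, ENNReal.inv_mul_cancel ne0 ENNReal.ofReal_ne_top, one_smul]
  have : IsFiniteMeasure (ENNReal.ofReal (3 * C) • m) :=
    Measure.smul_finite m ENNReal.ofReal_ne_top
  have fr : IsFiniteMeasure r := isFiniteMeasure_of_le _ hrle
  have fer : IsFiniteMeasure (e • r) := isFiniteMeasure_of_le _ erle
  have fs : IsFiniteMeasure s := by
    refine ⟨?_⟩
    have h1 : s univ = r univ := by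
      have := congrArg (fun ν => ν univ) hfst
      simpa [Measure.map_apply (show Measurable (fun q : (ℝ × ℝ) × ℝ => q.1) by fun_prop)]
        using this
    rw [h1]; exact measure_lt_top _ _
  set n := m - e • r with hn
  have hnm : n + e • r = m := Measure.sub_add_cancel_of_le erle
  have hnle : n ≤ m := Measure.sub_le
  have fn : IsFiniteMeasure n := isFiniteMeasure_of_le _ hnle
  set m' := n + e • s with hm'
  have hmap1 : m'.map (fun q => q.1) = m.map (fun q => q.1) := by
    rw [← hnm, hm', Measure.map_add _ _ (by fun_prop), Measure.map_add _ _ (by fun_prop),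
      Measure.map_smul, Measure.map_smul, hfst]
  have hmap2 : m'.map (fun q => q.2) = m.map (fun q => q.2) := by
    rw [← hnm, hm', Measure.map_add _ _ (by fun_prop), Measure.map_add _ _ (by fun_prop),
      Measure.map_smul, Measure.map_smul, hsnd]
  have hcomp : ∀ {β : Type} [MeasurableSpace β] {ψ : ℝ × ℝ → β}, Measurable ψ →
      m'.map (fun q => ψ q.1) = m.map (fun q => ψ q.1) := fun {β _ ψ} hψ => by
    have e1 : (fun q : (ℝ × ℝ) × ℝ => ψ q.1) = ψ ∘ (fun q => q.1) := rfl
    rw [e1, ← Measure.map_map hψ (by fun_prop), hmap1, Measure.map_map hψ (by fun_prop)]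
  -- integrals
  have ibd : ∀ {G : (ℝ × ℝ) × ℝ → ℝ} {D : ℝ}, Measurable G →
      (∀ q : (ℝ × ℝ) × ℝ, |q.1.2| ≤ K → |q.2| ≤ K → |G q| ≤ D) →
      ∀ ν : Measure ((ℝ × ℝ) × ℝ), IsFiniteMeasure ν →
      (∀ᵐ q ∂ν, |q.1.2| ≤ K ∧ |q.2| ≤ K) → Integrable G ν := by
    intro G D hG hD ν _ hν
    refine Integrable.of_bound hG.aestronglyMeasurable D ?_
    filter_upwards [hν] with q hq
    exact hD q hq.1 hq.2
  have bm : ∀ᵐ q ∂m, |q.1.2| ≤ K ∧ |q.2| ≤ K := (H.ae_bound hX hY hZ).mono fun q h => h.2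
  have br : ∀ᵐ q ∂r, |q.1.2| ≤ K ∧ |q.2| ≤ K :=
    (Measure.absolutelyContinuous_of_le hrle).ae_le (Measure.ae_smul_measure bm _)
  have bs : ∀ᵐ q ∂s, |q.1.2| ≤ K ∧ |q.2| ≤ K := by
    have m1 : Measurable (fun q : (ℝ × ℝ) × ℝ => q.1) := by fun_prop
    have m2 : Measurable (fun q : (ℝ × ℝ) × ℝ => q.2) := by fun_prop
    have h1 : ∀ᵐ t ∂(s.map fun q => q.1), |t.2| ≤ K := by
      rw [hfst, ae_map_iff m1.aemeasurable (measurableSet_le (by fun_prop) (by fun_prop))]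
      exact br.mono fun q h => h.1
    have h2 : ∀ᵐ t ∂(s.map fun q => q.2), |t| ≤ K := by
      rw [hsnd, ae_map_iff m2.aemeasurable (measurableSet_le (by fun_prop) (by fun_prop))]
      exact br.mono fun q h => h.2
    filter_upwards [ae_of_ae_map m1.aemeasurable h1, ae_of_ae_map m2.aemeasurable h2] with q h3 h4
    exact ⟨h3, h4⟩
  -- First-order effect of the exchange on an arbitrary observable `G`; it is used once for the
  -- martingale condition and once for the cost.
  have key : ∀ {G : (ℝ × ℝ) × ℝ → ℝ} {D : ℝ}, Measurable G →
      (∀ q : (ℝ × ℝ) × ℝ, |q.1.2| ≤ K → |q.2| ≤ K → |G q| ≤ D) →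
      Integrable (fun ω => u ω * G (p ω, a ω) + v ω * G (p ω, b ω) + w ω * G (p' ω, c ω) -
        (u ω * G (p' ω, a ω) + v ω * G (p' ω, b ω) + w ω * G (p ω, c ω))) Θ ∧
      ∫ q, G q ∂m' = ∫ q, G q ∂m - e.toReal *
      ∫ ω, (u ω * G (p ω, a ω) + v ω * G (p ω, b ω) + w ω * G (p' ω, c ω) -
        (u ω * G (p' ω, a ω) + v ω * G (p' ω, b ω) + w ω * G (p ω, c ω))) ∂Θ := by
    intro G D hG hD
    have im := ibd hG hD m inferInstance bm
    have ir := ibd hG hD r fr br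
    have is := ibd hG hD s fs bs
    have ir₁ := ir.mono_measure (show r₁ ≤ r from
      Measure.le_add_right (Measure.le_add_right le_rfl))
    have ir₂ := ir.mono_measure (show r₂ ≤ r from
      Measure.le_add_right (Measure.le_add_left le_rfl))
    have ir₃ := ir.mono_measure (show r₃ ≤ r from Measure.le_add_left le_rfl)
    have is₁ := is.mono_measure (show s₁ ≤ s from
      Measure.le_add_right (Measure.le_add_right le_rfl))
    have is₂ := is.mono_measure (show s₂ ≤ s from
      Measure.le_add_right (Measure.le_add_left le_rfl))
    have is₃ := is.mono_measure (show s₃ ≤ s from Measure.le_add_left le_rfl)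
    have Ir : ∫ q, G q ∂r = ∫ q, G q ∂r₁ + ∫ q, G q ∂r₂ + ∫ q, G q ∂r₃ := by
      rw [hr, integral_add_measure (ir₁.add_measure ir₂) ir₃, integral_add_measure ir₁ ir₂]
    have Is : ∫ q, G q ∂s = ∫ q, G q ∂s₁ + ∫ q, G q ∂s₂ + ∫ q, G q ∂s₃ := by
      rw [hs, integral_add_measure (is₁.add_measure is₂) is₃, integral_add_measure is₁ is₂]
    rw [integrable_weightedMap_iff hu u0 (by fun_prop) hG] at ir₁ is₁
    rw [integrable_weightedMap_iff hv v0 (by fun_prop) hG] at ir₂ is₂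
    rw [integrable_weightedMap_iff mw w0 (by fun_prop) hG] at ir₃ is₃
    rw [integral_weightedMap hu u0 (by fun_prop) hG, integral_weightedMap hv v0 (by fun_prop) hG,
      integral_weightedMap mw w0 (by fun_prop) hG] at Ir Is
    have jr : Integrable (fun ω => u ω * G (p ω, a ω) + v ω * G (p ω, b ω)) Θ := ir₁.add ir₂
    have jr' : Integrable (fun ω => u ω * G (p ω, a ω) + v ω * G (p ω, b ω) +
        w ω * G (p' ω, c ω)) Θ := jr.add ir₃
    have js : Integrable (fun ω => u ω * G (p' ω, a ω) + v ω * G (p' ω, b ω)) Θ := is₁.add is₂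
    have js' : Integrable (fun ω => u ω * G (p' ω, a ω) + v ω * G (p' ω, b ω) +
        w ω * G (p ω, c ω)) Θ := js.add is₃
    refine ⟨jr'.sub js', ?_⟩
    rw [integral_sub jr' js', integral_add jr ir₃, integral_add ir₁ ir₂, integral_add js is₃,
      integral_add is₁ is₂, ← Ir, ← Is]
    have e1 : ∫ q, G q ∂m = ∫ q, G q ∂n + e.toReal * ∫ q, G q ∂r := by
      rw [← hnm, integral_add_measure (im.mono_measure hnle) (ir.smul_measure etop),
        integral_smul_measure, smul_eq_mul]
    have e2 : ∫ q, G q ∂m' = ∫ q, G q ∂n + e.toReal * ∫ q, G q ∂s := by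
      rw [hm', integral_add_measure (im.mono_measure hnle) (is.smul_measure etop),
        integral_smul_measure, smul_eq_mul]
    rw [e1, e2]; ring
  refine ⟨m', ⟨?_, ?_, ?_, ?_, fun g hg D hD => ?_, fun g hg D hD => ?_⟩, e.toReal,
    ENNReal.toReal_pos e0 etop, ?_⟩
  · refine ⟨?_⟩
    have := congrArg (fun ν => ν univ) hmap1
    simpa [Measure.map_apply (show Measurable (fun q : (ℝ × ℝ) × ℝ => q.1) by fun_prop)]
        using this
  · rw [hcomp measurable_fst]; exact H.mapX
  · rw [hcomp measurable_snd]; exact H.mapY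
  · rw [hmap2]; exact H.mapZ
  · have e1 : ∀ ν : Measure ((ℝ × ℝ) × ℝ), ∫ q, g q.1.1 * (q.1.2 - q.1.1) ∂ν =
        ∫ t, g t.1 * (t.2 - t.1) ∂(ν.map fun q => q.1) := fun ν => by
      rw [integral_map (by fun_prop) (Measurable.aestronglyMeasurable (by fun_prop))]
    rw [e1, hmap1, ← e1]
    exact H.martY g hg D hD
  · have hb := (key (G := fun q => g q.1 * (q.2 - q.1.2)) (D := D * (K + K)) (by fun_prop)
      (fun q h1 h2 => by
        rw [abs_mul]
        exact mul_le_mul (hD _) ((abs_sub _ _).trans (add_le_add h2 h1)) (abs_nonneg _)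
          ((abs_nonneg _).trans (hD 0)))).2
    rw [hb, H.martZ g hg D hD]
    rw [integral_eq_zero_of_ae, mul_zero, sub_zero]
    refine Filter.Eventually.of_forall fun ω => ?_
    simp only [Pi.zero_apply, hw]
    -- The barycentre condition makes the exchange invisible to every martingale test.
    linear_combination (g (p ω) - g (p' ω)) * hbar ω
  · obtain ⟨h1, h2⟩ := key (G := fun q => F q.1 * q.2 ^ 2) (D := B * K ^ 2) (by fun_prop)
      (fun q h1 h2 => by
        rw [abs_mul, abs_pow]
        exact mul_le_mul (hB _) (pow_le_pow_left₀ (abs_nonneg _) h2 2) (by positivity)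
          ((abs_nonneg _).trans (hB 0)))
    refine ⟨_, fun ω => ?_, h1, h2⟩
    simp only [hw]
    ring

/-! ### Optimality forces monotonicity of `z` in `F` -/

/-- `m` minimizes `∫ F (x, y) z ^ 2` among martingale laws. -/
def IsMinimizer (μX μY μZ : Measure ℝ) (F : ℝ × ℝ → ℝ) (m : Measure ((ℝ × ℝ) × ℝ)) : Prop :=
  MartLaw μX μY μZ m ∧ ∀ m', MartLaw μX μY μZ m' →
    ∫ q, F q.1 * q.2 ^ 2 ∂m ≤ ∫ q, F q.1 * q.2 ^ 2 ∂m'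

/-- The law of `((p, a, b), (p', c))` where `(p', c)` has law `m` and is independent of `(p, a, b)`,
and `a`, `b` are independent samples of the second coordinate of `m` given the first one. -/
def resampledLaw (m : Measure ((ℝ × ℝ) × ℝ)) [IsFiniteMeasure m] :
    Measure (((ℝ × ℝ) × (ℝ × ℝ)) × ((ℝ × ℝ) × ℝ)) :=
  (m.fst ⊗ₘ (m.condKernel ×ₖ m.condKernel)).prod m

section resampledLaw

variable (m : Measure ((ℝ × ℝ) × ℝ)) [IsProbabilityMeasure m]

lemma resampledLaw_map_left :
    (resampledLaw m).map (fun ω => (ω.1.1, ω.1.2.1)) = m := by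
  have e : (fun ω : ((ℝ × ℝ) × (ℝ × ℝ)) × ((ℝ × ℝ) × ℝ) => (ω.1.1, ω.1.2.1)) =
      (Prod.map id Prod.fst) ∘ Prod.fst := rfl
  rw [e, ← Measure.map_map (by fun_prop) (by fun_prop), resampledLaw, Measure.map_fst_prod,
    measure_univ, one_smul, ← Measure.compProd_map measurable_fst, ← Kernel.fst_eq,
    Kernel.fst_prod, m.disintegrate]

lemma resampledLaw_map_right :
    (resampledLaw m).map (fun ω => (ω.1.1, ω.1.2.2)) = m := by
  have e : (fun ω : ((ℝ × ℝ) × (ℝ × ℝ)) × ((ℝ × ℝ) × ℝ) => (ω.1.1, ω.1.2.2)) =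
      (Prod.map id Prod.snd) ∘ Prod.fst := rfl
  rw [e, ← Measure.map_map (by fun_prop) (by fun_prop), resampledLaw, Measure.map_fst_prod,
    measure_univ, one_smul, ← Measure.compProd_map measurable_snd, ← Kernel.snd_eq,
    Kernel.snd_prod, m.disintegrate]

lemma resampledLaw_map_snd :
    (resampledLaw m).map (fun ω => (ω.2.1, ω.2.2)) = m := by
  have := Measure.map_snd_prod (μ := m.fst ⊗ₘ (m.condKernel ×ₖ m.condKernel)) (ν := m)
  rw [measure_univ, one_smul] at this
  exact this

end resampledLaw

/-- Larger levels of `F` are coupled to inner values of `z`. -/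
lemma IsMinimizer.resampledLaw_eq_zero {μX μY μZ : Measure ℝ} {K : ℝ} (hK : 0 < K)
    (hX : ∀ᵐ t ∂μX, |t| ≤ K) (hY : ∀ᵐ t ∂μY, |t| ≤ K) (hZ : ∀ᵐ t ∂μZ, |t| ≤ K)
    {F : ℝ × ℝ → ℝ} (hF : Measurable F) {B : ℝ} (hB : ∀ p, |F p| ≤ B)
    {m : Measure ((ℝ × ℝ) × ℝ)} [IsProbabilityMeasure m] (H : IsMinimizer μX μY μZ F m) :
    ∀ᵐ ω ∂(resampledLaw m),
      ¬ (F ω.2.1 < F ω.1.1 ∧ ω.1.2.1 < ω.2.2 ∧ ω.2.2 < ω.1.2.2) := by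
  set Θ := resampledLaw m with hΘ
  -- The forbidden configurations. The bounds by `K`, which hold a.e., keep the exchange weights
  -- below `2 * K`.
  set E : Set (((ℝ × ℝ) × (ℝ × ℝ)) × ((ℝ × ℝ) × ℝ)) :=
    {ω | (F ω.2.1 < F ω.1.1 ∧ ω.1.2.1 < ω.2.2 ∧ ω.2.2 < ω.1.2.2) ∧
      -K ≤ ω.1.2.1 ∧ ω.1.2.2 ≤ K} with hE
  have mE : MeasurableSet E := by
    have h1 : MeasurableSet {ω : ((ℝ × ℝ) × (ℝ × ℝ)) × ((ℝ × ℝ) × ℝ) | F ω.2.1 < F ω.1.1} :=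
      measurableSet_lt (by fun_prop) (by fun_prop)
    have h2 : MeasurableSet {ω : ((ℝ × ℝ) × (ℝ × ℝ)) × ((ℝ × ℝ) × ℝ) | ω.1.2.1 < ω.2.2} :=
      measurableSet_lt (by fun_prop) (by fun_prop)
    have h3 : MeasurableSet {ω : ((ℝ × ℝ) × (ℝ × ℝ)) × ((ℝ × ℝ) × ℝ) | ω.2.2 < ω.1.2.2} :=
      measurableSet_lt (by fun_prop) (by fun_prop)
    have h4 : MeasurableSet {ω : ((ℝ × ℝ) × (ℝ × ℝ)) × ((ℝ × ℝ) × ℝ) | -K ≤ ω.1.2.1} :=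
      measurableSet_le (by fun_prop) (by fun_prop)
    have h5 : MeasurableSet {ω : ((ℝ × ℝ) × (ℝ × ℝ)) × ((ℝ × ℝ) × ℝ) | ω.1.2.2 ≤ K} :=
      measurableSet_le (by fun_prop) (by fun_prop)
    exact (h1.inter (h2.inter h3)).inter (h4.inter h5)
  have nonneg_ind : ∀ {φ : ((ℝ × ℝ) × (ℝ × ℝ)) × ((ℝ × ℝ) × ℝ) → ℝ}, (∀ ω ∈ E, 0 ≤ φ ω) →
      ∀ ω, 0 ≤ E.indicator φ ω := fun h ω => indicator_nonneg h ω
  -- With `u = b - c` and `v = c - a` the point `c` is the barycentre of `a` and `b`. The gain on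
  -- `E` is then `(F p - F p') * (b - c) * (c - a) * (b - a) > 0`, while minimality allows no
  -- positive total gain.
  obtain ⟨m', hm', ε, hε, Δ, hΔ, iΔ, hcost⟩ := H.1.exchange hX hY hZ (Θ := Θ)
    (p := fun ω => ω.1.1) (p' := fun ω => ω.2.1) (a := fun ω => ω.1.2.1) (b := fun ω => ω.1.2.2)
    (c := fun ω => ω.2.2) (u := E.indicator fun ω => ω.1.2.2 - ω.2.2)
    (v := E.indicator fun ω => ω.2.2 - ω.1.2.1)
    (by fun_prop) (by fun_prop) (by fun_prop) (by fun_prop) (by fun_prop)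
    (Measurable.indicator (by fun_prop) mE) (Measurable.indicator (by fun_prop) mE)
    (nonneg_ind fun ω hω => by linarith [hω.1.2.2])
    (nonneg_ind fun ω hω => by linarith [hω.1.2.1])
    (C := 2 * K) (by positivity)
    (fun ω => by
      by_cases hω : ω ∈ E
      · simp only [indicator_of_mem hω]; linarith [hω.2.1, hω.2.2]
      · simp only [indicator_of_notMem hω]; linarith)
    (fun ω => by
      by_cases hω : ω ∈ E
      · simp only [indicator_of_mem hω]; ring
      · simp only [indicator_of_notMem hω]; ring)
    (resampledLaw_map_left m) (resampledLaw_map_right m) (resampledLaw_map_snd m) hF hB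
  have hmin := H.2 m' hm'
  have hΔE : ∀ ω ∈ E, 0 < Δ ω := by
    intro ω hω
    rw [hΔ]
    simp only [indicator_of_mem hω]
    have : (ω.1.2.2 - ω.2.2) * ω.1.2.1 ^ 2 + (ω.2.2 - ω.1.2.1) * ω.1.2.2 ^ 2 -
        (ω.1.2.2 - ω.2.2 + (ω.2.2 - ω.1.2.1)) * ω.2.2 ^ 2 =
        (ω.1.2.2 - ω.2.2) * (ω.2.2 - ω.1.2.1) * (ω.1.2.2 - ω.1.2.1) := by ring
    rw [this]
    obtain ⟨⟨h1, h2, h3⟩, -⟩ := hω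
    exact mul_pos (by linarith) (mul_pos (mul_pos (by linarith) (by linarith)) (by linarith))
  have hΔ0 : 0 ≤ Δ := by
    intro ω
    by_cases hω : ω ∈ E
    · exact (hΔE ω hω).le
    · rw [Pi.zero_apply, hΔ]
      simp only [indicator_of_notMem hω]
      simp
  have hint : ∫ ω, Δ ω ∂Θ = 0 := by
    refine le_antisymm ?_ (integral_nonneg hΔ0)
    by_contra! hpos
    nlinarith [mul_pos hε hpos]
  have h0 := (integral_eq_zero_iff_of_nonneg hΔ0 iΔ).1 hint
  have hz := hZ
  rw [← H.1.mapZ] at hz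
  have hz' := ae_of_ae_map (by fun_prop) hz
  have b1 : ∀ᵐ ω ∂Θ, |ω.1.2.1| ≤ K :=
    ae_of_ae_map (f := fun ω : ((ℝ × ℝ) × (ℝ × ℝ)) × ((ℝ × ℝ) × ℝ) => (ω.1.1, ω.1.2.1))
      (p := fun q => |q.2| ≤ K) (by fun_prop)
      (by rw [hΘ, resampledLaw_map_left]; exact hz')
  have b2 : ∀ᵐ ω ∂Θ, |ω.1.2.2| ≤ K :=
    ae_of_ae_map (f := fun ω : ((ℝ × ℝ) × (ℝ × ℝ)) × ((ℝ × ℝ) × ℝ) => (ω.1.1, ω.1.2.2))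
      (p := fun q => |q.2| ≤ K) (by fun_prop)
      (by rw [hΘ, resampledLaw_map_right]; exact hz')
  filter_upwards [h0, b1, b2] with ω h1 h2 h3 h4
  have := hΔE ω ⟨h4, (abs_le.1 h2).1, (abs_le.1 h3).2⟩
  rw [h1] at this
  exact lt_irrefl _ this

/-- Given `(x, y)`, the values of `z` lie on both sides of `y₁`. -/
lemma MartLaw.condKernel_ne_zero {μX μY μZ : Measure ℝ} {K : ℝ}
    (hY : ∀ᵐ t ∂μY, |t| ≤ K) (hZb : ∀ᵐ t ∂μZ, |t| ≤ K)
    {m : Measure ((ℝ × ℝ) × ℝ)} [IsProbabilityMeasure m] (H : MartLaw μX μY μZ m)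
    {y₀ y₁ y₂ zm zp : ℝ} (hzl : zm < y₀) (hzr : y₂ < zp)
    (hY' : ∀ᵐ y ∂μY, y ∈ Icc y₀ y₂) (hZ : ∀ᵐ z ∂μZ, z ≤ zm ∨ zp ≤ z)
    (hy : y₁ ∈ Icc y₀ y₂) :
    ∀ᵐ p ∂m.fst, m.condKernel p (Iio y₁) ≠ 0 ∧ m.condKernel p (Ioi y₁) ≠ 0 := by
  have iy := integrable_comp_of_map (by fun_prop) H.mapY hY
  have iz := integrable_comp_of_map (by fun_prop) H.mapZ hZb
  have h1 := condKernel_mean_of_test m (h := fun z => z) (k := fun p => p.2) iz iy measurable_snd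
    fun g hg hgs => by
      obtain ⟨C, hC⟩ := hgs.exists_bound_of_continuous hg
      exact H.martZ g hg.measurable C hC
  rw [← H.mapY] at hY'
  have h2 : ∀ᵐ p ∂m.fst, p.2 ∈ Icc y₀ y₂ := by
    rw [Measure.fst, ae_map_iff (by fun_prop) (measurable_snd measurableSet_Icc)]
    exact ae_of_ae_map (by fun_prop) hY'
  rw [← H.mapZ] at hZ
  have h3 : ∀ᵐ p ∂m.fst, ∀ᵐ z ∂(m.condKernel p), z ≤ zm ∨ zp ≤ z := by
    have h := ae_of_ae_map (by fun_prop) hZ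
    rw [← m.disintegrate m.condKernel] at h
    exact Measure.ae_ae_of_ae_compProd h
  have h4 : ∀ᵐ p ∂m.fst, Integrable (fun z => z) (m.condKernel p) := by
    have hm := iz.1
    rw [← m.disintegrate m.condKernel, Measure.integrable_compProd_iff
      (by rw [m.disintegrate m.condKernel]; exact hm)] at iz
    exact iz.1
  filter_upwards [h1, h2, h3, h4] with p e1 e2 e3 e4
  -- If one side were null, `z` would stay beyond `zp` or below `zm`, against its conditional mean
  -- lying in `[y₀, y₂]`.
  refine ⟨fun h0 => ?_, fun h0 => ?_⟩
  · have hge : ∀ᵐ z ∂(m.condKernel p), zp ≤ z := by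
      have h5 : ∀ᵐ z ∂(m.condKernel p), z ∉ Iio y₁ := measure_eq_zero_iff_ae_notMem.1 h0
      filter_upwards [e3, h5] with z hz hz'
      rcases hz with hz | hz
      · exact absurd (show z < y₁ by linarith [hy.1]) hz'
      · exact hz
    have := integral_mono_ae (integrable_const zp) e4 hge
    rw [e1] at this
    simp at this
    linarith [e2.2]
  · have hle : ∀ᵐ z ∂(m.condKernel p), z ≤ zm := by
      have h5 : ∀ᵐ z ∂(m.condKernel p), z ∉ Ioi y₁ := measure_eq_zero_iff_ae_notMem.1 h0
      filter_upwards [e3, h5] with z hz hz'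
      rcases hz with hz | hz
      · exact hz
      · exact absurd (show y₁ < z by linarith [hy.2]) hz'
    have := integral_mono_ae e4 (integrable_const zm) hle
    rw [e1] at this
    simp at this
    linarith [e2.1]

/-- Independence splits the measure of the box: `(p', c)` is independent of the rest, and given `p`
the samples `a` and `b` are independent, so the mass of `L ×ˢ R` is a product of kernel masses. -/
lemma resampledLaw_prod_eq_zero {m : Measure ((ℝ × ℝ) × ℝ)} [IsProbabilityMeasure m]
    {A B : Set (ℝ × ℝ)} {L M R : Set ℝ} (hA : MeasurableSet A)
    (hL : MeasurableSet L) (hR : MeasurableSet R)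
    (h : resampledLaw m ((A ×ˢ (L ×ˢ R)) ×ˢ (B ×ˢ M)) = 0) :
    (∀ᵐ p ∂m.fst, p ∈ A → m.condKernel p L = 0 ∨ m.condKernel p R = 0) ∨ m (B ×ˢ M) = 0 := by
  rw [resampledLaw, Measure.prod_prod, mul_eq_zero] at h
  refine h.imp (fun h => ?_) id
  rw [Measure.compProd_apply_prod hA (hL.prod hR), lintegral_eq_zero_iff (by
    exact Kernel.measurable_coe _ (hL.prod hR)), Filter.EventuallyEq, ae_restrict_iff' hA] at h
  filter_upwards [h] with p hp hpA
  have := hp hpA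
  rw [Kernel.prod_apply_prod] at this
  simpa using this

lemma measure_prod_eq_zero_of_condKernel {m : Measure ((ℝ × ℝ) × ℝ)} [IsProbabilityMeasure m]
    {A : Set (ℝ × ℝ)} {L : Set ℝ} (hA : MeasurableSet A) (hL : MeasurableSet L)
    (h : ∀ᵐ p ∂m.fst, p ∈ A → m.condKernel p L = 0) : m (A ×ˢ L) = 0 := by
  rw [← m.disintegrate m.condKernel, Measure.compProd_apply_prod hA hL, lintegral_eq_zero_iff
    (Kernel.measurable_coe _ hL), Filter.EventuallyEq, ae_restrict_iff' hA]
  simpa [Measure.disintegrate] using h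

/-- Below `y₁`, the variable `z` is comonotone with `F (x, y)`. -/
lemma IsMinimizer.comonotone {μX μY μZ : Measure ℝ} {K : ℝ} (hK : 0 < K)
    (hX : ∀ᵐ t ∂μX, |t| ≤ K) (hY : ∀ᵐ t ∂μY, |t| ≤ K) (hZb : ∀ᵐ t ∂μZ, |t| ≤ K)
    {F : ℝ × ℝ → ℝ} (hF : Measurable F) {B : ℝ} (hB : ∀ p, |F p| ≤ B)
    {m : Measure ((ℝ × ℝ) × ℝ)} [IsProbabilityMeasure m] (H : IsMinimizer μX μY μZ F m)
    {y₀ y₁ y₂ zm zp : ℝ} (hzl : zm < y₀) (hzr : y₂ < zp)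
    (hY' : ∀ᵐ y ∂μY, y ∈ Icc y₀ y₂) (hZ : ∀ᵐ z ∂μZ, z ≤ zm ∨ zp ≤ z)
    (hy : y₁ ∈ Icc y₀ y₂) (t q : ℝ) :
    (m ({p | t < F p} ×ˢ (Iio y₁ ∩ Iio q)) = 0 ∨ m ({p | F p ≤ t} ×ˢ (Iio y₁ ∩ Ici q)) = 0) ∧
    (m ({p | t < F p} ×ˢ (Ioi y₁ ∩ Ioi q)) = 0 ∨ m ({p | F p ≤ t} ×ˢ (Ioi y₁ ∩ Iic q)) = 0) := by
  have h0 := H.resampledLaw_eq_zero hK hX hY hZb hF hB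
  have hne := H.1.condKernel_ne_zero hY hZb hzl hzr hY' hZ hy
  have mA : MeasurableSet {p | t < F p} := measurableSet_lt measurable_const hF
  constructor
  -- If `a < q ≤ c < y₁ < b`, then `c` lies between `a` and `b`. The fibre always charges `Ioi y₁`,
  -- where `b` is taken, so the vanishing factor must be the one for `a`. The second half is the
  -- mirror image.
  · have := resampledLaw_prod_eq_zero (m := m) (A := {p | t < F p}) (B := {p | F p ≤ t})
      (L := Iio y₁ ∩ Iio q) (M := Iio y₁ ∩ Ici q) (R := Ioi y₁) mA
      (measurableSet_Iio.inter measurableSet_Iio) measurableSet_Ioi (by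
        rw [measure_eq_zero_iff_ae_notMem]
        filter_upwards [h0] with ω hω
        rintro ⟨⟨h1, h2, h3⟩, h4, h5⟩
        exact hω ⟨lt_of_le_of_lt h4 h1, lt_of_lt_of_le h2.2 h5.2, lt_trans h5.1 h3⟩)
    refine this.imp (fun h => measure_prod_eq_zero_of_condKernel mA
      (measurableSet_Iio.inter measurableSet_Iio) ?_) id
    filter_upwards [h, hne] with p h1 h2 hp
    exact (h1 hp).resolve_right h2.2
  · have := resampledLaw_prod_eq_zero (m := m) (A := {p | t < F p}) (B := {p | F p ≤ t})
      (L := Iio y₁) (M := Ioi y₁ ∩ Iic q) (R := Ioi y₁ ∩ Ioi q) mA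
      measurableSet_Iio (measurableSet_Ioi.inter measurableSet_Ioi) (by
        rw [measure_eq_zero_iff_ae_notMem]
        filter_upwards [h0] with ω hω
        rintro ⟨⟨h1, h2, h3⟩, h4, h5⟩
        exact hω ⟨lt_of_le_of_lt h4 h1, lt_trans h2 h5.1, lt_of_le_of_lt h5.2 h3.2⟩)
    refine this.imp (fun h => measure_prod_eq_zero_of_condKernel mA
      (measurableSet_Ioi.inter measurableSet_Ioi) ?_) id
    filter_upwards [h, hne] with p h1 h2 hp
    exact (h1 hp).resolve_left h2.1

/-- If `a` and `b` are comonotone and have no atoms, then `b` is a monotone function of `a`. -/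
lemma exists_monotone_of_comonotone {Ω : Type*} [MeasurableSpace Ω] {μ : Measure Ω}
    {a b : Ω → ℝ} {β₀ β₁ : ℝ} (hβ : β₀ ≤ β₁) (hb : ∀ᵐ ω ∂μ, b ω ∈ Icc β₀ β₁)
    (h : ∀ t q, (∀ᵐ ω ∂μ, ¬ (t < a ω ∧ b ω < q)) ∨ ∀ᵐ ω ∂μ, ¬ (a ω ≤ t ∧ q ≤ b ω))
    (hna : ∀ t, ∀ᵐ ω ∂μ, a ω ≠ t) (hnb : ∀ q, ∀ᵐ ω ∂μ, b ω ≠ q) :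
    ∃ Q : ℝ → ℝ, Monotone Q ∧ (∀ t, Q t ∈ Icc β₀ β₁) ∧ (∀ t, ∀ᵐ ω ∂μ, t < a ω ↔ Q t < b ω) ∧
      ∀ᵐ ω ∂μ, b ω = Q (a ω) := by
  -- `Q t` is the largest essential lower bound for `b` on `{t < a}`, capped to `[β₀, β₁]`.
  -- Thresholds below it satisfy the first alternative in `h`; a threshold in `(Q t, β₁]` fails it,
  -- so must satisfy the second.
  set S : ℝ → Set ℝ := fun t => {q | q ∈ Icc β₀ β₁ ∧ ∀ᵐ ω ∂μ, ¬ (t < a ω ∧ b ω < q)} with hS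
  have hmem : ∀ t, β₀ ∈ S t := fun t => ⟨⟨le_rfl, hβ⟩, by
    filter_upwards [hb] with ω hω h1
    linarith [hω.1, h1.2]⟩
  have hbdd : ∀ t, BddAbove (S t) := fun t => ⟨β₁, fun q hq => hq.1.2⟩
  set Q : ℝ → ℝ := fun t => sSup (S t) with hQ
  have hmono : Monotone Q := by
    intro t t' htt'
    refine csSup_le_csSup (hbdd t') ⟨_, hmem t⟩ fun q hq => ⟨hq.1, ?_⟩
    filter_upwards [hq.2] with ω h1 h2
    exact h1 ⟨lt_of_le_of_lt htt' h2.1, h2.2⟩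
  have hQm : ∀ t, Q t ∈ Icc β₀ β₁ := fun t =>
    ⟨le_csSup (hbdd t) (hmem t), csSup_le ⟨_, hmem t⟩ fun q hq => hq.1.2⟩
  have hiff : ∀ t, ∀ᵐ ω ∂μ, t < a ω ↔ Q t < b ω := by
    intro t
    -- Rational thresholds keep the exceptional sets countable in number; the remaining case `b = Q
    -- t` is null because `b` has no atoms.
    have h1 : ∀ᵐ ω ∂μ, ∀ r : ℚ, (r : ℝ) < Q t → ¬ (t < a ω ∧ b ω < r) := by
      rw [ae_all_iff]
      intro r
      by_cases hr : (r : ℝ) < Q t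
      · obtain ⟨q, hq, hrq⟩ := exists_lt_of_lt_csSup ⟨_, hmem t⟩ hr
        filter_upwards [hq.2] with ω h2 _ h3
        exact h2 ⟨h3.1, h3.2.trans hrq⟩
      · exact Filter.Eventually.of_forall fun ω h => absurd h hr
    have h2 : ∀ᵐ ω ∂μ, ∀ r : ℚ, Q t < r → ¬ (a ω ≤ t ∧ (r : ℝ) ≤ b ω) := by
      rw [ae_all_iff]
      intro r
      by_cases hr : Q t < (r : ℝ)
      · rcases le_or_gt (r : ℝ) β₁ with hr1 | hr1
        · have hnot : ¬ ∀ᵐ ω ∂μ, ¬ (t < a ω ∧ b ω < r) := fun h3 =>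
            absurd (le_csSup (hbdd t) (show (r : ℝ) ∈ S t from
              ⟨⟨(hQm t).1.trans hr.le, hr1⟩, h3⟩)) (not_le.2 hr)
          filter_upwards [(h t r).resolve_left hnot] with ω h3 _
          exact h3
        · filter_upwards [hb] with ω h3 _ h4
          linarith [h3.2, h4.2]
      · exact Filter.Eventually.of_forall fun ω h => absurd h hr
    filter_upwards [h1, h2, hnb (Q t)] with ω h1 h2 h3
    constructor
    · intro h4
      by_contra! h5
      obtain ⟨r, hr1, hr2⟩ := exists_rat_btwn (lt_of_le_of_ne h5 h3)
      exact h1 r hr2 ⟨h4, hr1⟩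
    · intro h4
      by_contra! h5
      obtain ⟨r, hr1, hr2⟩ := exists_rat_btwn h4
      exact h2 r hr1 ⟨h5, hr2.le⟩
  refine ⟨Q, hmono, hQm, hiff, ?_⟩
  -- A monotone function has countably many discontinuities and `a` has no atoms, so `a` avoids them
  -- a.e. At a continuity point, comparing `b` with `Q r` for rational `r` near `a` leaves only `b =
  -- Q a`.
  have hc : ∀ᵐ ω ∂μ, ∀ x ∈ {x | ¬ ContinuousAt Q x}, a ω ≠ x :=
    (ae_ball_iff hmono.countable_not_continuousAt).2 fun x _ => hna x
  have hr : ∀ᵐ ω ∂μ, ∀ r : ℚ, (r : ℝ) < a ω ↔ Q r < b ω := ae_all_iff.2 fun r => hiff r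
  filter_upwards [hc, hr] with ω h1 h2
  have hcont : ContinuousAt Q (a ω) := by
    by_contra h3
    exact h1 _ h3 rfl
  rcases lt_trichotomy (b ω) (Q (a ω)) with h3 | h3 | h3
  · exfalso
    obtain ⟨l, u, hlu, hsub⟩ := mem_nhds_iff_exists_Ioo_subset.1
      (hcont.eventually (lt_mem_nhds h3))
    obtain ⟨r, hr1, hr2⟩ := exists_rat_btwn hlu.1
    have h4 : b ω < Q r := hsub ⟨hr1, hr2.trans hlu.2⟩
    exact lt_asymm h4 ((h2 r).1 hr2)
  · exact h3
  · exfalso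
    obtain ⟨l, u, hlu, hsub⟩ := mem_nhds_iff_exists_Ioo_subset.1
      (hcont.eventually (gt_mem_nhds h3))
    obtain ⟨r, hr1, hr2⟩ := exists_rat_btwn hlu.2
    have h4 : Q r < b ω := hsub ⟨hlu.1.trans hr1, hr2⟩
    exact lt_asymm hr1 ((h2 r).2 h4)

/-! ### Midpoints of minimizers and the level structure -/

lemma MartLaw.average {μX μY μZ : Measure ℝ} {K : ℝ}
    (hX : ∀ᵐ t ∂μX, |t| ≤ K) (hY : ∀ᵐ t ∂μY, |t| ≤ K) (hZ : ∀ᵐ t ∂μZ, |t| ≤ K)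
    {m₁ m₂ : Measure ((ℝ × ℝ) × ℝ)} (h₁ : MartLaw μX μY μZ m₁) (h₂ : MartLaw μX μY μZ m₂) :
    MartLaw μX μY μZ ((2 : ENNReal)⁻¹ • (m₁ + m₂)) := by
  have p₁ := h₁.prob
  have p₂ := h₂.prob
  have half : ∀ μ : Measure ℝ, (2 : ENNReal)⁻¹ • (μ + μ) = μ := fun μ => by
    rw [← two_smul ENNReal μ, smul_smul, ENNReal.inv_mul_cancel (by simp) (by simp), one_smul]
  have mp : ∀ φ : (ℝ × ℝ) × ℝ → ℝ, Measurable φ → ((2 : ENNReal)⁻¹ • (m₁ + m₂)).map φ =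
      (2 : ENNReal)⁻¹ • (m₁.map φ + m₂.map φ) := fun φ hφ => by
    rw [Measure.map_smul, Measure.map_add _ _ hφ]
  have hint : ∀ {G : (ℝ × ℝ) × ℝ → ℝ}, Integrable G m₁ → Integrable G m₂ →
      ∫ q, G q ∂m₁ = 0 → ∫ q, G q ∂m₂ = 0 → ∫ q, G q ∂((2 : ENNReal)⁻¹ • (m₁ + m₂)) = 0 := by
    intro G i₁ i₂ e₁ e₂
    rw [integral_smul_measure, integral_add_measure i₁ i₂, e₁, e₂]
    simp
  refine ⟨⟨?_⟩, ?_, ?_, ?_, fun g hg C hC => hint ?_ ?_ (h₁.martY g hg C hC) (h₂.martY g hg C hC),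
    fun g hg C hC => hint ?_ ?_ (h₁.martZ g hg C hC) (h₂.martZ g hg C hC)⟩
  · rw [Measure.smul_apply, Measure.add_apply, measure_univ, measure_univ, smul_eq_mul,
      one_add_one_eq_two, ENNReal.inv_mul_cancel (by simp) (by simp)]
  · rw [mp _ (by fun_prop), h₁.mapX, h₂.mapX, half]
  · rw [mp _ (by fun_prop), h₁.mapY, h₂.mapY, half]
  · rw [mp _ (by fun_prop), h₁.mapZ, h₂.mapZ, half]
  · exact ((integrable_comp_of_map (by fun_prop) h₁.mapY hY).sub
      (integrable_comp_of_map (by fun_prop) h₁.mapX hX)).bdd_mul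
      (Measurable.aestronglyMeasurable (by fun_prop))
      (Filter.Eventually.of_forall fun q => hC q.1.1)
  · exact ((integrable_comp_of_map (by fun_prop) h₂.mapY hY).sub
      (integrable_comp_of_map (by fun_prop) h₂.mapX hX)).bdd_mul
      (Measurable.aestronglyMeasurable (by fun_prop))
      (Filter.Eventually.of_forall fun q => hC q.1.1)
  · exact ((integrable_comp_of_map (by fun_prop) h₁.mapZ hZ).sub
      (integrable_comp_of_map (by fun_prop) h₁.mapY hY)).bdd_mul
      (Measurable.aestronglyMeasurable (by fun_prop))
      (Filter.Eventually.of_forall fun q => hC q.1)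
  · exact ((integrable_comp_of_map (by fun_prop) h₂.mapZ hZ).sub
      (integrable_comp_of_map (by fun_prop) h₂.mapY hY)).bdd_mul
      (Measurable.aestronglyMeasurable (by fun_prop))
      (Filter.Eventually.of_forall fun q => hC q.1)

/-- Constraints and cost are linear in the law. The midpoint is the device for comparing two
minimizers: what holds a.e. for it holds a.e. for both, with the same auxiliary functions. -/
lemma IsMinimizer.average {μX μY μZ : Measure ℝ} {K : ℝ}
    (hX : ∀ᵐ t ∂μX, |t| ≤ K) (hY : ∀ᵐ t ∂μY, |t| ≤ K) (hZ : ∀ᵐ t ∂μZ, |t| ≤ K)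
    {F : ℝ × ℝ → ℝ} (hF : Measurable F) {B : ℝ} (hB : ∀ p, |F p| ≤ B)
    {m₁ m₂ : Measure ((ℝ × ℝ) × ℝ)} (h₁ : IsMinimizer μX μY μZ F m₁)
    (h₂ : IsMinimizer μX μY μZ F m₂) :
    IsMinimizer μX μY μZ F ((2 : ENNReal)⁻¹ • (m₁ + m₂)) := by
  refine ⟨h₁.1.average hX hY hZ h₂.1, fun m' hm' => ?_⟩
  have hint : ∀ m, MartLaw μX μY μZ m → Integrable (fun q : (ℝ × ℝ) × ℝ => F q.1 * q.2 ^ 2) m := by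
    intro m hm
    have := hm.prob
    refine Integrable.of_bound (Measurable.aestronglyMeasurable (by fun_prop)) (B * K ^ 2) ?_
    filter_upwards [hm.ae_bound hX hY hZ] with q hq
    rw [Real.norm_eq_abs, abs_mul, abs_pow]
    exact mul_le_mul (hB _) (pow_le_pow_left₀ (abs_nonneg _) hq.2.2 2) (by positivity)
      ((abs_nonneg _).trans (hB 0))
  rw [integral_smul_measure, integral_add_measure (hint _ h₁.1) (hint _ h₂.1)]
  have a₁ := h₁.2 m' hm'
  have a₂ := h₂.2 m' hm'
  simp
  linarith

lemma ae_of_ae_average {Ω : Type*} [MeasurableSpace Ω] {m₁ m₂ : Measure Ω} {P : Ω → Prop}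
    (h : ∀ᵐ ω ∂((2 : ENNReal)⁻¹ • (m₁ + m₂)), P ω) : (∀ᵐ ω ∂m₁, P ω) ∧ ∀ᵐ ω ∂m₂, P ω := by
  rw [← ae_add_measure_iff]
  exact (Measure.absolutelyContinuous_smul (c := (2 : ENNReal)⁻¹) (by simp)).ae_le h

/-- For a minimizer, `z` is a function of `F (x, y)` on each side of `y₁`, and the upper level sets
of `F` are the sets `{l t < z < r t}`. -/
lemma IsMinimizer.exists_levels {μX μY μZ : Measure ℝ} {K : ℝ} (hK : 0 < K)
    (hX : ∀ᵐ t ∂μX, |t| ≤ K) (hY : ∀ᵐ t ∂μY, |t| ≤ K) (hZb : ∀ᵐ t ∂μZ, |t| ≤ K)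
    {F : ℝ × ℝ → ℝ} (hF : Measurable F) {B : ℝ} (hB : ∀ p, |F p| ≤ B)
    {m : Measure ((ℝ × ℝ) × ℝ)} (H : IsMinimizer μX μY μZ F m)
    {y₀ y₁ y₂ zm zp : ℝ} (hzl : zm < y₀) (hzr : y₂ < zp) (hzK : -K ≤ zm) (hzK' : zp ≤ K)
    (hY' : ∀ᵐ y ∂μY, y ∈ Icc y₀ y₂) (hZ : ∀ᵐ z ∂μZ, z ≤ zm ∨ zp ≤ z)
    (hy : y₁ ∈ Icc y₀ y₂) (hZna : ∀ z, μZ {z} = 0) (hFna : ∀ t, ∀ᵐ q ∂m, F q.1 ≠ t) :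
    ∃ l r : ℝ → ℝ, Measurable l ∧ Measurable r ∧ (∀ t, l t ∈ Icc (-K) zm) ∧
      (∀ t, r t ∈ Icc zp K) ∧
      (∀ t, ∀ᵐ q ∂m, t < F q.1 ↔ (q.2 < y₁ ∧ l t < q.2) ∨ (y₁ < q.2 ∧ q.2 < r t)) ∧
      ∀ᵐ q ∂m, (q.2 < y₁ ∧ q.2 = l (F q.1)) ∨ (y₁ < q.2 ∧ q.2 = r (F q.1)) := by
  have hprob := H.1.prob
  have hco := H.comonotone hK hX hY hZb hF hB hzl hzr hY' hZ hy
  have hzna : ∀ z, ∀ᵐ q ∂m, q.2 ≠ z := fun z => by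
    have : ∀ᵐ t ∂μZ, t ≠ z := by
      rw [ae_iff]; simpa using hZna z
    rw [← H.1.mapZ] at this
    exact ae_of_ae_map (f := fun q : (ℝ × ℝ) × ℝ => q.2) (p := fun t => t ≠ z) (by fun_prop) this
  rw [← H.1.mapZ] at hZ hZb
  have hz := ae_of_ae_map (by fun_prop) hZ
  have hzb := ae_of_ae_map (by fun_prop) hZb
  have mL : MeasurableSet {q : (ℝ × ℝ) × ℝ | q.2 < y₁} :=
    measurableSet_lt (by fun_prop) (by fun_prop)
  have mR : MeasurableSet {q : (ℝ × ℝ) × ℝ | y₁ < q.2} :=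
    measurableSet_lt (by fun_prop) (by fun_prop)
  obtain ⟨l, lm, lmem, hl1, hl2⟩ := exists_monotone_of_comonotone
    (μ := m.restrict {q | q.2 < y₁}) (a := fun q => F q.1) (b := fun q => q.2) hzK
    (by
      rw [ae_restrict_iff' mL]
      filter_upwards [hz, hzb] with q h1 h2 h3
      refine ⟨(abs_le.1 h2).1, h1.resolve_right fun h4 => ?_⟩
      have : q.2 < y₁ := h3
      linarith [hy.2])
    (fun t q => by
      refine (hco t q).1.imp (fun h => ?_) (fun h => ?_) <;>
      · rw [ae_restrict_iff' mL]
        filter_upwards [measure_eq_zero_iff_ae_notMem.1 h] with ω h1 h2 h3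
        exact h1 ⟨h3.1, h2, h3.2⟩)
    (fun t => ae_restrict_of_ae (hFna t)) (fun t => ae_restrict_of_ae (hzna t))
  -- On the right of `y₁`, `z` decreases as `F` grows, so the monotone representation is applied to
  -- `-z` and the sign undone afterwards.
  obtain ⟨r, rm, rmem, hr1, hr2⟩ := exists_monotone_of_comonotone
    (μ := m.restrict {q | y₁ < q.2}) (a := fun q => F q.1) (b := fun q => -q.2)
    (neg_le_neg hzK')
    (by
      rw [ae_restrict_iff' mR]
      filter_upwards [hz, hzb] with q h1 h2 h3
      have : y₁ < q.2 := h3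
      have h5 : zp ≤ q.2 := h1.resolve_left fun h4 => by linarith [hy.1]
      exact ⟨by linarith [(abs_le.1 h2).2], by linarith⟩)
    (fun t q => by
      refine (hco t (-q)).2.imp (fun h => ?_) (fun h => ?_) <;>
      · rw [ae_restrict_iff' mR]
        filter_upwards [measure_eq_zero_iff_ae_notMem.1 h] with ω h1 h2 h3
        refine h1 ⟨h3.1, h2, ?_⟩
        simp only [mem_Ioi, mem_Iic]
        linarith [h3.2])
    (fun t => ae_restrict_of_ae (hFna t)) (fun t => by
      filter_upwards [ae_restrict_of_ae (hzna (-t))] with q h1 h2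
      exact h1 (by linarith))
  refine ⟨l, fun t => -r t, lm.measurable, rm.measurable.neg, lmem, fun t =>
    ⟨by linarith [(rmem t).2], by linarith [(rmem t).1]⟩, fun t => ?_, ?_⟩
  · have h1 := hl1 t
    have h2 := hr1 t
    rw [ae_restrict_iff' mL] at h1
    rw [ae_restrict_iff' mR] at h2
    filter_upwards [h1, h2, hzna y₁] with q h1 h2 h3
    rcases lt_or_gt_of_ne h3 with h4 | h4
    · rw [h1 h4]
      constructor
      · exact fun h => Or.inl ⟨h4, h⟩
      · rintro (h | h)
        · exact h.2
        · exact absurd h4 (lt_asymm h.1)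
    · rw [h2 h4, lt_neg]
      constructor
      · exact fun h => Or.inr ⟨h4, h⟩
      · rintro (h | h)
        · exact absurd h4 (lt_asymm h.1)
        · exact h.2
  · rw [ae_restrict_iff' mL] at hl2
    rw [ae_restrict_iff' mR] at hr2
    filter_upwards [hl2, hr2, hzna y₁] with q h1 h2 h3
    rcases lt_or_gt_of_ne h3 with h4 | h4
    · exact Or.inl ⟨h4, h1 h4⟩
    · exact Or.inr ⟨h4, by linarith [h2 h4]⟩

/-! ### From the law of `(x, y)` to the full law -/

/-- A martingale law concentrated on two graphs is determined by the law of `(x, y)`. -/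
lemma MartLaw.eq_of_map_fst_eq {μX μY μZ : Measure ℝ} {K : ℝ} (hY : ∀ᵐ t ∂μY, |t| ≤ K)
    (hZ : ∀ᵐ t ∂μZ, |t| ≤ K) {m₁ m₂ : Measure ((ℝ × ℝ) × ℝ)} (h₁ : MartLaw μX μY μZ m₁)
    (h₂ : MartLaw μX μY μZ m₂) (hfst : m₁.map (fun q => q.1) = m₂.map (fun q => q.1))
    {U V : ℝ × ℝ → ℝ} (mU : Measurable U) (mV : Measurable V) {zm zp y₁ : ℝ} (hz : zm < zp)
    (hU : ∀ p, U p ∈ Icc (-K) zm) (hV : ∀ p, V p ∈ Icc zp K)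
    (g₁ : ∀ᵐ q ∂m₁, (q.2 < y₁ ∧ q.2 = U q.1) ∨ (y₁ < q.2 ∧ q.2 = V q.1))
    (g₂ : ∀ᵐ q ∂m₂, (q.2 < y₁ ∧ q.2 = U q.1) ∨ (y₁ < q.2 ∧ q.2 = V q.1)) : m₁ = m₂ := by
  have p₁ := h₁.prob
  have p₂ := h₂.prob
  have ifst : ∀ G : ℝ × ℝ → ℝ, Measurable G → ∫ q, G q.1 ∂m₁ = ∫ q, G q.1 ∂m₂ := by
    intro G hG
    have e : ∀ m : Measure ((ℝ × ℝ) × ℝ), ∫ q, G q.1 ∂m = ∫ p, G p ∂(m.map fun q => q.1) :=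
      fun m => by rw [integral_map (by fun_prop) hG.aestronglyMeasurable]
    rw [e, e, hfst]
  have hleft : ∀ A : Set (ℝ × ℝ), MeasurableSet A → m₁ (A ×ˢ Iio y₁) = m₂ (A ×ˢ Iio y₁) := by
    intro A hA
    -- Given `p`, `z` is `U p` or `V p` with mean `p.2`, so it is `U p` with probability `(V p -
    -- p.2) / (V p - U p)`, a function of `p` alone. The gap `zp - zm` keeps the test function `g`
    -- bounded.
    set g : ℝ × ℝ → ℝ := A.indicator fun p => (V p - U p)⁻¹ with hg
    have mg : Measurable g := (mV.sub mU).inv.indicator hA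
    have hVU : ∀ p, 0 < zp - zm ∧ zp - zm ≤ V p - U p := fun p =>
      ⟨by linarith, by linarith [(hU p).2, (hV p).1]⟩
    have gb : ∀ p, |g p| ≤ (zp - zm)⁻¹ := fun p => by
      have h0 : 0 ≤ (zp - zm)⁻¹ := inv_nonneg.2 (by linarith)
      by_cases hp : p ∈ A
      · rw [hg, indicator_of_mem hp, abs_of_nonneg (inv_nonneg.2 (by linarith [hVU p]))]
        exact inv_anti₀ (hVU p).1 (hVU p).2
      · rw [hg, indicator_of_notMem hp, abs_zero]; exact h0
    have key : ∀ m : Measure ((ℝ × ℝ) × ℝ), MartLaw μX μY μZ m →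
        (∀ᵐ q ∂m, (q.2 < y₁ ∧ q.2 = U q.1) ∨ (y₁ < q.2 ∧ q.2 = V q.1)) →
        m.real (A ×ˢ Iio y₁) = ∫ q, g q.1 * (V q.1 - q.1.2) ∂m := by
      intro m hm hgm
      have pm := hm.prob
      have iz := integrable_comp_of_map (by fun_prop) hm.mapZ hZ
      have iy := integrable_comp_of_map (by fun_prop) hm.mapY hY
      have iV : Integrable (fun q : (ℝ × ℝ) × ℝ => V q.1) m :=
        Integrable.of_bound (Measurable.aestronglyMeasurable (by fun_prop)) (max |zp| |K|)
          (Filter.Eventually.of_forall fun q => abs_le_max_abs_abs (hV q.1).1 (hV q.1).2)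
      have hbm : AEStronglyMeasurable (fun q : (ℝ × ℝ) × ℝ => g q.1) m :=
        Measurable.aestronglyMeasurable (by fun_prop)
      have hbb : ∀ᵐ q ∂m, ‖g q.1‖ ≤ (zp - zm)⁻¹ := Filter.Eventually.of_forall fun q => gb q.1
      have i1 : Integrable (fun q : (ℝ × ℝ) × ℝ => g q.1 * (V q.1 - q.2)) m :=
        (iV.sub iz).bdd_mul hbm hbb
      have i2 : Integrable (fun q : (ℝ × ℝ) × ℝ => g q.1 * (q.2 - q.1.2)) m :=
        (iz.sub iy).bdd_mul hbm hbb
      have e1 : ∫ q, g q.1 * (V q.1 - q.1.2) ∂m = ∫ q, g q.1 * (V q.1 - q.2) ∂m := by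
        rw [← add_zero (∫ q, g q.1 * (V q.1 - q.2) ∂m), ← hm.martZ g mg _ gb, ← integral_add i1 i2]
        congr 1
        funext q
        ring
      have mS : MeasurableSet (A ×ˢ Iio y₁) := hA.prod measurableSet_Iio
      rw [e1, ← integral_indicator_one mS]
      refine integral_congr_ae ?_
      filter_upwards [hgm] with q hq
      by_cases hA' : q.1 ∈ A
      · simp only [hg, indicator_of_mem hA']
        rcases hq with hq | hq
        · rw [indicator_of_mem (show q ∈ A ×ˢ Iio y₁ from ⟨hA', hq.1⟩), hq.2, Pi.one_apply,
            inv_mul_cancel₀ (by linarith [hVU q.1] : 0 < V q.1 - U q.1).ne']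
        · rw [indicator_of_notMem (fun h => lt_asymm hq.1 h.2), hq.2, sub_self, mul_zero]
      · rw [indicator_of_notMem (fun h => hA' h.1)]
        simp only [hg, indicator_of_notMem hA', zero_mul]
    have e := (key m₁ h₁ g₁).trans
      ((ifst (fun p => g p * (V p - p.2)) (by fun_prop)).trans (key m₂ h₂ g₂).symm)
    rw [measureReal_def, measureReal_def,
      ENNReal.toReal_eq_toReal_iff' (measure_ne_top _ _) (measure_ne_top _ _)] at e
    exact e
  have hright : ∀ A : Set (ℝ × ℝ), MeasurableSet A →
      m₁ (A ×ˢ (Iio y₁)ᶜ) = m₂ (A ×ˢ (Iio y₁)ᶜ) := by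
    intro A hA
    have e : ∀ m : Measure ((ℝ × ℝ) × ℝ),
        m (A ×ˢ Iio y₁) + m (A ×ˢ (Iio y₁)ᶜ) = m.map (fun q => q.1) A := by
      intro m
      rw [Measure.map_apply (by fun_prop) hA, ← measure_union
        (by rw [Set.disjoint_prod]; exact Or.inr disjoint_compl_right)
        (hA.prod measurableSet_Iio.compl), ← Set.prod_union, Set.union_compl_self, Set.prod_univ]
    have e₁ := e m₁
    rw [hfst, ← e m₂, hleft A hA] at e₁
    exact (ENNReal.add_right_inj (measure_ne_top _ _)).1 e₁
  refine Measure.ext_prod fun {s t} hs ht => ?_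
  -- On either graph the event `z ∈ t` is a condition on `p`, so rectangles reduce to the two
  -- half-line cases already treated.
  have e : ∀ m : Measure ((ℝ × ℝ) × ℝ),
      (∀ᵐ q ∂m, (q.2 < y₁ ∧ q.2 = U q.1) ∨ (y₁ < q.2 ∧ q.2 = V q.1)) →
      m (s ×ˢ t) = m ((s ∩ U ⁻¹' t) ×ˢ Iio y₁) + m ((s ∩ V ⁻¹' t) ×ˢ (Iio y₁)ᶜ) := by
    intro m hm
    rw [← measure_union (by rw [Set.disjoint_prod]; exact Or.inr disjoint_compl_right)
      ((hs.inter (mV ht)).prod measurableSet_Iio.compl)]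
    refine measure_congr ?_
    filter_upwards [hm] with q hq
    refine propext ?_
    change (q.1 ∈ s ∧ q.2 ∈ t) ↔ (((q.1 ∈ s ∧ U q.1 ∈ t) ∧ q.2 < y₁) ∨
      ((q.1 ∈ s ∧ V q.1 ∈ t) ∧ ¬ q.2 < y₁))
    rcases hq with ⟨h1, h2⟩ | ⟨h1, h2⟩
    · rw [← h2]; tauto
    · have : ¬ q.2 < y₁ := lt_asymm h1
      rw [← h2]; tauto
  rw [e m₁ g₁, e m₂ g₂, hleft _ (hs.inter (mU ht)), hright _ (hs.inter (mV ht))]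

/-! ### The law of `(x, y)` is determined by its level data -/

/-- A function which does not change along the steps `u ↦ v`, `G₀ v = G₁ u`, vanishes. -/
lemma eq_zero_of_step {xl xr : ℝ} (hx : xl ≤ xr) {G₀ G₁ D : ℝ → ℝ}
    (h₀ : ContinuousOn G₀ (Icc xl xr)) (h₁ : ContinuousOn G₁ (Icc xl xr))
    (hlt : ∀ x ∈ Icc xl xr, G₁ x < G₀ x)
    (hD : ∀ u ∈ Icc xl xr, ∀ v ∈ Icc xl xr, G₀ v = G₁ u → D u = D v)
    (hD0 : ∀ u ∈ Icc xl xr, G₁ u < G₀ xr → D u = 0) : ∀ u ∈ Icc xl xr, D u = 0 := by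
  obtain ⟨x₀, hx₀, hmin⟩ := isCompact_Icc.exists_isMinOn (nonempty_Icc.2 hx) (h₀.sub h₁)
  have hε : 0 < G₀ x₀ - G₁ x₀ := by linarith [hlt x₀ hx₀]
  have huc := isCompact_Icc.uniformContinuousOn_of_continuous h₀
  obtain ⟨δ, hδ, hδ'⟩ := Metric.uniformContinuousOn_iff.1 huc _ hε
  -- A step from `u` to `v` has `G₀ u - G₀ v = G₀ u - G₁ u`, at least the minimal gap, so uniform
  -- continuity of `G₀` gives `δ ≤ v - u`. The induction therefore works backwards from `xr` in
  -- strides of `δ`.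
  have main : ∀ n : ℕ, ∀ u ∈ Icc xl xr, xr - n * δ ≤ u → D u = 0 := by
    intro n
    induction n with
    | zero =>
      intro u hu h
      have : u = xr := le_antisymm hu.2 (by simpa using h)
      exact hD0 u hu (by rw [this]; exact hlt xr (right_mem_Icc.2 hx))
    | succ n ih =>
      intro u hu h
      rcases lt_or_ge (G₁ u) (G₀ xr) with h2 | h2
      · exact hD0 u hu h2
      · obtain ⟨v, hv, hv'⟩ := intermediate_value_Icc' hu.2
          (h₀.mono (Icc_subset_Icc_left hu.1)) ⟨h2, (hlt u hu).le⟩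
        have hv2 : v ∈ Icc xl xr := ⟨hu.1.trans hv.1, hv.2⟩
        rw [hD u hu v hv2 hv']
        refine ih v hv2 ?_
        have h3 : δ ≤ v - u := by
          by_contra! h4
          have h5 := hδ' v hv2 u hu (by rw [Real.dist_eq, abs_of_nonneg (by linarith [hv.1])]
                                        exact h4)
          rw [Real.dist_eq, hv', abs_sub_comm] at h5
          have h6 : G₀ x₀ - G₁ x₀ ≤ G₀ u - G₁ u := hmin hu
          linarith [le_abs_self (G₀ u - G₁ u)]
        push_cast at h
        linarith
  intro u hu
  obtain ⟨n, hn⟩ := exists_nat_ge ((xr - u) / δ)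
  refine main n u hu ?_
  rw [div_le_iff₀ hδ] at hn
  linarith

lemma setIntegral_snd_threePoint {μ : Measure (ℝ × ℝ)} [IsFiniteMeasure μ] {y₀ y₁ y₂ : ℝ}
    (h01 : y₀ < y₁) (h12 : y₁ < y₂) (hy : ∀ᵐ p ∂μ, p.2 = y₀ ∨ p.2 = y₁ ∨ p.2 = y₂)
    {A : Set (ℝ × ℝ)} (hA : MeasurableSet A) (φ : ℝ → ℝ) :
    ∫ p in A, φ p.2 ∂μ = φ y₀ * μ.real (A ∩ {p | p.2 = y₀}) + φ y₁ * μ.real (A ∩ {p | p.2 = y₁}) +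
      φ y₂ * μ.real (A ∩ {p | p.2 = y₂}) := by
  have mS : ∀ y : ℝ, MeasurableSet (A ∩ {p : ℝ × ℝ | p.2 = y}) := fun y =>
    hA.inter (measurableSet_eq_fun (by fun_prop) (by fun_prop))
  have i : ∀ y, Integrable (fun p => φ y * (A ∩ {p : ℝ × ℝ | p.2 = y}).indicator (1 : ℝ × ℝ → ℝ) p) μ :=
    fun y => ((integrable_const (1 : ℝ)).indicator (mS y)).const_mul _
  have i2 : Integrable (fun p => φ y₀ * (A ∩ {p : ℝ × ℝ | p.2 = y₀}).indicator (1 : ℝ × ℝ → ℝ) p +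
      φ y₁ * (A ∩ {p : ℝ × ℝ | p.2 = y₁}).indicator (1 : ℝ × ℝ → ℝ) p) μ := (i y₀).add (i y₁)
  rw [← integral_indicator_one (mS y₀), ← integral_indicator_one (mS y₁),
    ← integral_indicator_one (mS y₂), ← integral_const_mul, ← integral_const_mul,
    ← integral_const_mul, ← integral_add (i y₀) (i y₁), ← integral_add i2 (i y₂),
    ← integral_indicator hA]
  refine integral_congr_ae ?_
  filter_upwards [hy] with p hp
  by_cases hpA : p ∈ A
  · have e : ∀ y, (A ∩ {p : ℝ × ℝ | p.2 = y}).indicator (1 : ℝ × ℝ → ℝ) p = if p.2 = y then 1 else 0 := by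
      intro y
      simp [indicator, hpA]
    rw [indicator_of_mem hpA, e, e, e]
    rcases hp with h | h | h <;> rw [h]
    · simp [h01.ne, (h01.trans h12).ne]
    · simp [h01.ne', h12.ne]
    · simp [(h01.trans h12).ne', h12.ne']
  · have e : ∀ y, (A ∩ {p : ℝ × ℝ | p.2 = y}).indicator (1 : ℝ × ℝ → ℝ) p = 0 := fun y =>
      indicator_of_notMem (fun h => hpA h.1) _
    rw [indicator_of_notMem hpA, e, e, e]
    simp

/-- Two laws of `(x, y)`, `y` with three values, agree if they have the same marginals, the same
conditional means of `y` given `x`, and the same masses and means of `y` above each level of `F`. -/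
lemma eq_of_level_eq {μ₁ μ₂ : Measure (ℝ × ℝ)} [IsProbabilityMeasure μ₁] [IsProbabilityMeasure μ₂]
    {μX : Measure ℝ} (hX₁ : μ₁.map Prod.fst = μX) (hX₂ : μ₂.map Prod.fst = μX)
    {xl xr : ℝ} (hx : xl ≤ xr) (hX : ∀ᵐ x ∂μX, x ∈ Icc xl xr) (hXna : ∀ x, ∀ᵐ t ∂μX, t ≠ x)
    {y₀ y₁ y₂ : ℝ} (h01 : y₀ < y₁) (h12 : y₁ < y₂)
    (hy₁ : ∀ᵐ p ∂μ₁, p.2 = y₀ ∨ p.2 = y₁ ∨ p.2 = y₂)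
    (hy₂ : ∀ᵐ p ∂μ₂, p.2 = y₀ ∨ p.2 = y₁ ∨ p.2 = y₂)
    (hy : μ₁ {p | p.2 = y₁} = μ₂ {p | p.2 = y₁})
    (hmean : ∀ C : Set ℝ, MeasurableSet C →
      ∫ p in Prod.fst ⁻¹' C, p.2 ∂μ₁ = ∫ p in Prod.fst ⁻¹' C, p.2 ∂μ₂)
    {F : ℝ × ℝ → ℝ} (hF : Continuous F)
    (hF₀ : StrictAntiOn (fun x => F (x, y₀)) (Icc xl xr))
    (hF₁ : StrictAntiOn (fun x => F (x, y₁)) (Icc xl xr))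
    (hF₀₁ : ∀ x ∈ Icc xl xr, F (x, y₁) < F (x, y₀))
    (hlev : ∀ t, μ₁ {p | t < F p} = μ₂ {p | t < F p})
    (hlevm : ∀ t, ∫ p in {p | t < F p}, p.2 ∂μ₁ = ∫ p in {p | t < F p}, p.2 ∂μ₂) :
    μ₁ = μ₂ := by
  -- The difference of the two laws on the line at height `y`, as a set function of `x`; the goal is
  -- that it vanishes at all three heights.
  set d : ℝ → Set ℝ → ℝ := fun y C => μ₁.real (Prod.fst ⁻¹' C ∩ {p | p.2 = y}) -
    μ₂.real (Prod.fst ⁻¹' C ∩ {p | p.2 = y}) with hd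
  have hsec : ∀ (A : Set (ℝ × ℝ)) (y : ℝ), A ∩ {p | p.2 = y} =
      Prod.fst ⁻¹' {x | (x, y) ∈ A} ∩ {p | p.2 = y} := by
    intro A y
    ext ⟨a, b⟩
    simp only [mem_inter_iff, mem_ofPred_eq, mem_preimage]
    constructor
    · rintro ⟨h, rfl⟩; exact ⟨h, rfl⟩
    · rintro ⟨h, rfl⟩; exact ⟨h, rfl⟩
  have hdA : ∀ (A : Set (ℝ × ℝ)) (y : ℝ), μ₁.real (A ∩ {p | p.2 = y}) -
      μ₂.real (A ∩ {p | p.2 = y}) = d y {x | (x, y) ∈ A} := fun A y => by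
    simp only [hd]; rw [hsec]
  have hmass : ∀ {A : Set (ℝ × ℝ)}, MeasurableSet A → μ₁.real A - μ₂.real A =
      d y₀ {x | (x, y₀) ∈ A} + d y₁ {x | (x, y₁) ∈ A} + d y₂ {x | (x, y₂) ∈ A} := by
    intro A hA
    have e₁ := setIntegral_snd_threePoint h01 h12 hy₁ hA fun _ => 1
    have e₂ := setIntegral_snd_threePoint h01 h12 hy₂ hA fun _ => 1
    simp only [setIntegral_const, smul_eq_mul, mul_one, one_mul] at e₁ e₂
    rw [e₁, e₂, ← hdA, ← hdA, ← hdA]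
    ring
  have hmom : ∀ {A : Set (ℝ × ℝ)}, MeasurableSet A → ∫ p in A, p.2 ∂μ₁ - ∫ p in A, p.2 ∂μ₂ =
      y₀ * d y₀ {x | (x, y₀) ∈ A} + y₁ * d y₁ {x | (x, y₁) ∈ A} + y₂ * d y₂ {x | (x, y₂) ∈ A} := by
    intro A hA
    have e₁ := setIntegral_snd_threePoint h01 h12 hy₁ hA fun y => y
    have e₂ := setIntegral_snd_threePoint h01 h12 hy₂ hA fun y => y
    rw [e₁, e₂, ← hdA, ← hdA, ← hdA]
    ring
  -- Equal mass and equal `y`-integral on `A` are two linear equations in three unknowns, so the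
  -- differences at the three heights are multiples of one fixed vector, and the one at `y₁`
  -- decides.
  have hprop : ∀ {A : Set (ℝ × ℝ)}, MeasurableSet A → μ₁ A = μ₂ A →
      ∫ p in A, p.2 ∂μ₁ = ∫ p in A, p.2 ∂μ₂ →
      (y₂ - y₀) * d y₀ {x | (x, y₀) ∈ A} = -((y₂ - y₁) * d y₁ {x | (x, y₁) ∈ A}) ∧
      (y₂ - y₀) * d y₂ {x | (x, y₂) ∈ A} = -((y₁ - y₀) * d y₁ {x | (x, y₁) ∈ A}) := by
    intro A hA h1 h2
    have e₁ := hmass hA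
    have e₂ := hmom hA
    rw [measureReal_def, measureReal_def, h1, sub_self] at e₁
    rw [h2, sub_self] at e₂
    constructor
    · linear_combination e₂ - y₂ * e₁
    · linear_combination y₀ * e₁ - e₂
  have hcyl : ∀ {C : Set ℝ}, MeasurableSet C →
      (y₂ - y₀) * d y₀ C = -((y₂ - y₁) * d y₁ C) ∧ (y₂ - y₀) * d y₂ C = -((y₁ - y₀) * d y₁ C) := by
    intro C hC
    refine hprop (A := Prod.fst ⁻¹' C) (measurable_fst hC) ?_ (hmean C hC)
    rw [← Measure.map_apply measurable_fst hC, ← Measure.map_apply measurable_fst hC, hX₁, hX₂]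
  have hcongr : ∀ {C C' : Set ℝ} (y : ℝ), (∀ᵐ x ∂μX, x ∈ C ↔ x ∈ C') → d y C = d y C' := by
    intro C C' y h
    have e : ∀ μ : Measure (ℝ × ℝ), μ.map Prod.fst = μX →
        μ.real (Prod.fst ⁻¹' C ∩ {p | p.2 = y}) = μ.real (Prod.fst ⁻¹' C' ∩ {p | p.2 = y}) := by
      intro μ hμ
      rw [← hμ] at h
      refine measureReal_congr ?_
      filter_upwards [ae_of_ae_map measurable_fst.aemeasurable h] with p hp
      exact propext (and_congr_left fun _ => hp)
    simp only [hd]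
    rw [e μ₁ hX₁, e μ₂ hX₂]
  have mlev : ∀ t, MeasurableSet {p | t < F p} := fun t =>
    measurableSet_lt measurable_const hF.measurable
  have mlev' : ∀ t y, MeasurableSet {x | t < F (x, y)} := fun t y =>
    measurableSet_lt measurable_const (by fun_prop)
  -- The level set and the cylinder over `{x | t < F (x, y₀)}` have the same section at `y₀`. By
  -- proportionality in both, their sections at `y₁` carry the same difference.
  have hstep : ∀ t, d y₁ {x | t < F (x, y₁)} = d y₁ {x | t < F (x, y₀)} := by
    intro t
    have e₁ := (hprop (mlev t) (hlev t) (hlevm t)).1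
    have e₂ := (hcyl (mlev' t y₀)).1
    simp only [mem_ofPred_eq] at e₁
    have e₃ : (y₂ - y₁) * d y₁ {x | t < F (x, y₁)} = (y₂ - y₁) * d y₁ {x | t < F (x, y₀)} := by
      linarith
    exact mul_left_cancel₀ (by linarith : y₂ - y₁ > 0).ne' e₃
  have huniv : d y₁ univ = 0 := by
    simp only [hd, preimage_univ, univ_inter, measureReal_def, hy, sub_self]
  have hIic : ∀ {y : ℝ}, StrictAntiOn (fun x => F (x, y)) (Icc xl xr) → ∀ v ∈ Icc xl xr,
      d y₁ {x | F (v, y) < F (x, y)} = d y₁ (Iic v) := by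
    intro y hanti v hv
    refine hcongr y₁ ?_
    filter_upwards [hX, hXna v] with x hx hxv
    exact (hanti.lt_iff_gt hv hx).trans ⟨fun h => le_of_lt h, fun h => lt_of_le_of_ne h hxv⟩
  have hzero : ∀ u ∈ Icc xl xr, d y₁ (Iic u) = 0 := by
    refine eq_zero_of_step hx (G₀ := fun x => F (x, y₀)) (G₁ := fun x => F (x, y₁))
      (Continuous.continuousOn (by fun_prop)) (Continuous.continuousOn (by fun_prop)) hF₀₁ ?_ ?_
    · intro u hu v hv huv
      rw [← hIic hF₁ u hu, ← hIic hF₀ v hv, hstep, huv]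
    -- The level `F (u, y₁)` lies below all values of `F (·, y₀)`, so the section at `y₀` is
    -- everything, and the total difference at `y₁` is zero because the two laws give `y₁` equal
    -- mass.
    · intro u hu hu'
      rw [← hIic hF₁ u hu, hstep, ← huniv]
      refine hcongr y₁ ?_
      filter_upwards [hX] with x hx'
      simp only [mem_univ, iff_true]
      exact lt_of_lt_of_le hu' (hF₀.antitoneOn hx' (right_mem_Icc.2 hx) hx'.2)
  have hzero' : ∀ u, d y₁ (Iic u) = 0 := by
    intro u
    rcases lt_or_ge u xl with h | h
    · rw [hcongr (C' := ∅) y₁ (by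
        filter_upwards [hX] with x hx'
        simp only [mem_Iic, mem_empty_iff_false, iff_false, not_le]
        linarith [hx'.1])]
      simp [hd]
    · rcases le_or_gt u xr with h' | h'
      · exact hzero u ⟨h, h'⟩
      · rw [hcongr (C' := univ) y₁ (by
          filter_upwards [hX] with x hx'
          simp only [mem_Iic, mem_univ, iff_true]
          linarith [hx'.2]), huniv]
  have mS : MeasurableSet {p : ℝ × ℝ | p.2 = y₁} :=
    measurableSet_eq_fun (by fun_prop) (by fun_prop)
  have hν : (μ₁.restrict {p | p.2 = y₁}).map Prod.fst = (μ₂.restrict {p | p.2 = y₁}).map Prod.fst := by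
    refine Measure.ext_of_Iic _ _ fun u => ?_
    rw [Measure.map_apply measurable_fst measurableSet_Iic,
      Measure.map_apply measurable_fst measurableSet_Iic,
      Measure.restrict_apply (measurable_fst measurableSet_Iic),
      Measure.restrict_apply (measurable_fst measurableSet_Iic)]
    have := sub_eq_zero.1 (hzero' u)
    rwa [measureReal_def, measureReal_def,
      ENNReal.toReal_eq_toReal_iff' (measure_ne_top _ _) (measure_ne_top _ _)] at this
  have hd1 : ∀ {C : Set ℝ}, MeasurableSet C → d y₁ C = 0 := by
    intro C hC
    have := congrArg (fun ν => ν C) hν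
    simp only [Measure.map_apply measurable_fst hC,
      Measure.restrict_apply (measurable_fst hC)] at this
    simp only [hd, measureReal_def, this, sub_self]
  have y20 : (y₂ - y₀) ≠ 0 := by linarith
  have hd0 : ∀ {C : Set ℝ}, MeasurableSet C → d y₀ C = 0 := fun hC => by
    have := (hcyl hC).1
    rw [hd1 hC, mul_zero, neg_zero] at this
    exact (mul_eq_zero.1 this).resolve_left y20
  have hd2 : ∀ {C : Set ℝ}, MeasurableSet C → d y₂ C = 0 := fun hC => by
    have := (hcyl hC).2
    rw [hd1 hC, mul_zero, neg_zero] at this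
    exact (mul_eq_zero.1 this).resolve_left y20
  ext A hA
  have e := hmass hA
  have msec : ∀ y, MeasurableSet {x | (x, y) ∈ A} := fun y =>
    (show Measurable fun x : ℝ => (x, y) by fun_prop) hA
  rw [hd0 (msec _), hd1 (msec _), hd2 (msec _)] at e
  have e' : μ₁.real A = μ₂.real A := by linarith
  rwa [measureReal_def, measureReal_def,
    ENNReal.toReal_eq_toReal_iff' (measure_ne_top _ _) (measure_ne_top _ _)] at e'

/-- The martingale property tested on the indicator of `A`. On a level set of `F`, an event in `z`
alone for minimizers, it turns the `y`-integral into one against `μZ`. -/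
lemma MartLaw.setIntegral_z {μX μY μZ : Measure ℝ} {K : ℝ} (hY : ∀ᵐ t ∂μY, |t| ≤ K)
    (hZ : ∀ᵐ t ∂μZ, |t| ≤ K) {m : Measure ((ℝ × ℝ) × ℝ)} (h : MartLaw μX μY μZ m)
    {A : Set (ℝ × ℝ)} (hA : MeasurableSet A) :
    ∫ p in A, p.2 ∂(m.map fun q => q.1) = ∫ q in {q : (ℝ × ℝ) × ℝ | q.1 ∈ A}, q.2 ∂m := by
  have := h.prob
  have iz := integrable_comp_of_map (by fun_prop) h.mapZ hZ
  have iy := integrable_comp_of_map (by fun_prop) h.mapY hY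
  have mA : MeasurableSet {q : (ℝ × ℝ) × ℝ | q.1 ∈ A} := measurable_fst hA
  have e := h.martZ (A.indicator 1) (measurable_one.indicator hA) 1 (fun p => by
    by_cases hp : p ∈ A <;> simp [hp])
  have e2 : ∫ q, A.indicator 1 q.1 * (q.2 - q.1.2) ∂m =
      ∫ q in {q : (ℝ × ℝ) × ℝ | q.1 ∈ A}, (q.2 - q.1.2) ∂m := by
    rw [← integral_indicator mA]
    congr 1
    funext q
    by_cases hq : q.1 ∈ A <;> simp [hq]
  rw [e2, integral_sub iz.integrableOn iy.integrableOn] at e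
  rw [setIntegral_map hA (Measurable.aestronglyMeasurable (by fun_prop)) (by fun_prop)]
  exact (sub_eq_zero.1 e).symm

lemma MartLaw.setIntegral_y {μX μY μZ : Measure ℝ} {K : ℝ} (hX : ∀ᵐ t ∂μX, |t| ≤ K)
    (hY : ∀ᵐ t ∂μY, |t| ≤ K) {m : Measure ((ℝ × ℝ) × ℝ)} (h : MartLaw μX μY μZ m)
    {C : Set ℝ} (hC : MeasurableSet C) :
    ∫ p in Prod.fst ⁻¹' C, p.2 ∂(m.map fun q => q.1) = ∫ x in C, x ∂μX := by
  have := h.prob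
  have ix := integrable_comp_of_map (by fun_prop) h.mapX hX
  have iy := integrable_comp_of_map (by fun_prop) h.mapY hY
  have mC : MeasurableSet {q : (ℝ × ℝ) × ℝ | q.1.1 ∈ C} := measurable_fst (measurable_fst hC)
  have e := h.martY (C.indicator 1) (measurable_one.indicator hC) 1 (fun p => by
    by_cases hp : p ∈ C <;> simp [hp])
  have e2 : ∫ q, C.indicator 1 q.1.1 * (q.1.2 - q.1.1) ∂m =
      ∫ q in {q : (ℝ × ℝ) × ℝ | q.1.1 ∈ C}, (q.1.2 - q.1.1) ∂m := by
    rw [← integral_indicator mC]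
    congr 1
    funext q
    by_cases hq : q.1.1 ∈ C <;> simp [hq]
  rw [e2, integral_sub iy.integrableOn ix.integrableOn] at e
  rw [setIntegral_map (measurable_fst hC) (Measurable.aestronglyMeasurable (by fun_prop))
    (by fun_prop), ← h.mapX,
    setIntegral_map hC (Measurable.aestronglyMeasurable (by fun_prop)) (by fun_prop)]
  exact sub_eq_zero.1 e

/-! ### Uniqueness, and return to the original problem -/

/-- The martingale transport problem has at most one solution. -/
lemma IsMinimizer.unique {μX μY μZ : Measure ℝ} {K : ℝ} (hK : 0 < K)
    (hXb : ∀ᵐ t ∂μX, |t| ≤ K) (hYb : ∀ᵐ t ∂μY, |t| ≤ K) (hZb : ∀ᵐ t ∂μZ, |t| ≤ K)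
    {xl xr : ℝ} (hx : xl ≤ xr) (hX : ∀ᵐ x ∂μX, x ∈ Icc xl xr) [NullSingletonClass μX]
    {y₀ y₁ y₂ zm zp : ℝ} (h01 : y₀ < y₁) (h12 : y₁ < y₂) (hzl : zm < y₀) (hzr : y₂ < zp)
    (hzK : -K ≤ zm) (hzK' : zp ≤ K)
    (hY : ∀ᵐ y ∂μY, y = y₀ ∨ y = y₁ ∨ y = y₂) (hZ : ∀ᵐ z ∂μZ, z ≤ zm ∨ zp ≤ z)
    (hZna : ∀ z, μZ {z} = 0)
    {F : ℝ × ℝ → ℝ} (hF : Continuous F) {B : ℝ} (hB : ∀ p, |F p| ≤ B)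
    (hanti : ∀ y ∈ Icc y₀ y₂, StrictAntiOn (fun x => F (x, y)) (Icc xl xr))
    (hF₀₁ : ∀ x ∈ Icc xl xr, F (x, y₁) < F (x, y₀))
    {m₁ m₂ : Measure ((ℝ × ℝ) × ℝ)} (h₁ : IsMinimizer μX μY μZ F m₁)
    (h₂ : IsMinimizer μX μY μZ F m₂) : m₁ = m₂ := by
  have p₁ := h₁.1.prob
  have p₂ := h₂.1.prob
  have my₀ : y₀ ∈ Icc y₀ y₂ := ⟨le_rfl, by linarith⟩
  have my₁ : y₁ ∈ Icc y₀ y₂ := ⟨h01.le, h12.le⟩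
  have my₂ : y₂ ∈ Icc y₀ y₂ := ⟨by linarith, le_rfl⟩
  have hYI : ∀ᵐ y ∂μY, y ∈ Icc y₀ y₂ := by
    filter_upwards [hY] with y h
    rcases h with h | h | h <;> rw [h] <;> assumption
  have hXna : ∀ x, ∀ᵐ t ∂μX, t ≠ x := fun x => by
    rw [ae_iff]; simp
  have h := h₁.average hXb hYb hZb hF.measurable hB h₂
  -- `F (x, y)` has no atoms: at each of the three heights it is injective in `x`, and `μX` has
  -- none.
  have hFna : ∀ t, ∀ᵐ q ∂((2 : ENNReal)⁻¹ • (m₁ + m₂)), F q.1 ≠ t := by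
    intro t
    have hs : ∀ y ∈ Icc y₀ y₂, ∀ᵐ x ∂μX, x ∈ Icc xl xr → F (x, y) ≠ t := by
      intro y hy
      have hsub : ({x | x ∈ Icc xl xr ∧ F (x, y) = t} : Set ℝ).Subsingleton := by
        intro a ha b hb
        exact (hanti y hy).injOn ha.1 hb.1 (ha.2.trans hb.2.symm)
      have := hsub.measure_zero μX
      rw [measure_eq_zero_iff_ae_notMem] at this
      filter_upwards [this] with x h1 h2 h3
      exact h1 ⟨h2, h3⟩
    have hx' : ∀ᵐ x ∂μX, F (x, y₀) ≠ t ∧ F (x, y₁) ≠ t ∧ F (x, y₂) ≠ t := by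
      filter_upwards [hX, hs y₀ my₀, hs y₁ my₁, hs y₂ my₂] with x h1 h2 h3 h4
      exact ⟨h2 h1, h3 h1, h4 h1⟩
    rw [← h.1.mapX] at hx'
    have hY'' := hY
    rw [← h.1.mapY] at hY''
    filter_upwards [ae_of_ae_map (by fun_prop) hx', ae_of_ae_map (by fun_prop) hY''] with q h1 h2
    rw [← Prod.mk.eta (p := q.1)]
    rcases h2 with h2 | h2 | h2 <;> rw [h2]
    · exact h1.1
    · exact h1.2.1
    · exact h1.2.2
  obtain ⟨l, r, ml, mr, hl, hr, hlev, hgr⟩ := h.exists_levels hK hXb hYb hZb hF.measurable hB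
    hzl hzr hzK hzK' hYI hZ my₁ hZna hFna
  obtain ⟨g₁, g₂⟩ := ae_of_ae_average hgr
  refine h₁.1.eq_of_map_fst_eq hYb hZb h₂.1 ?_ (ml.comp hF.measurable) (mr.comp hF.measurable)
    (by linarith) (fun p => hl _) (fun p => hr _) g₁ g₂
  have q₁ : IsProbabilityMeasure (m₁.map fun q => q.1) :=
    Measure.isProbabilityMeasure_map (by fun_prop)
  have q₂ : IsProbabilityMeasure (m₂.map fun q => q.1) :=
    Measure.isProbabilityMeasure_map (by fun_prop)
  have hmapX : ∀ m, MartLaw μX μY μZ m → (m.map fun q => q.1).map Prod.fst = μX := fun m hm => by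
    rw [Measure.map_map measurable_fst (by fun_prop)]; exact hm.mapX
  have hmapY : ∀ m, MartLaw μX μY μZ m → (m.map fun q => q.1).map Prod.snd = μY := fun m hm => by
    rw [Measure.map_map measurable_snd (by fun_prop)]; exact hm.mapY
  have hy3 : ∀ m, MartLaw μX μY μZ m →
      ∀ᵐ p ∂(m.map fun q => q.1), p.2 = y₀ ∨ p.2 = y₁ ∨ p.2 = y₂ := fun m hm => by
    rw [← hmapY m hm] at hY
    exact ae_of_ae_map measurable_snd.aemeasurable hY
  have hyy : ∀ m, MartLaw μX μY μZ m → (m.map fun q => q.1) {p | p.2 = y₁} = μY {y₁} :=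
    fun m hm => by
      rw [← hmapY m hm, Measure.map_apply measurable_snd (measurableSet_singleton _)]; rfl
  -- `S t` depends only on the common `l` and `r`, so both minimizers give `{t < F}` the mass `μZ (S
  -- t)` and the `y`-integral `∫ z in S t, z ∂μZ`.
  set S : ℝ → Set ℝ := fun t => {z | (z < y₁ ∧ l t < z) ∨ (y₁ < z ∧ z < r t)} with hS
  have mS : ∀ t, MeasurableSet (S t) := fun t =>
    ((measurableSet_lt measurable_id measurable_const).inter
      (measurableSet_lt measurable_const measurable_id)).union
    ((measurableSet_lt measurable_const measurable_id).inter
      (measurableSet_lt measurable_id measurable_const))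
  have mF : ∀ t, MeasurableSet {p | t < F p} := fun t =>
    measurableSet_lt measurable_const hF.measurable
  have hset : ∀ (m : Measure ((ℝ × ℝ) × ℝ)) t, (∀ᵐ q ∂m, t < F q.1 ↔ q.2 ∈ S t) →
      {q : (ℝ × ℝ) × ℝ | q.1 ∈ {p | t < F p}} =ᵐ[m] (fun q => q.2) ⁻¹' (S t) := by
    intro m t hm
    filter_upwards [hm] with q hq
    exact propext hq
  have hlev1 : ∀ m, MartLaw μX μY μZ m → ∀ t, (∀ᵐ q ∂m, t < F q.1 ↔ q.2 ∈ S t) →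
      (m.map fun q => q.1) {p | t < F p} = μZ (S t) := by
    intro m hm t hmt
    rw [Measure.map_apply (by fun_prop) (mF t), ← hm.mapZ, Measure.map_apply (by fun_prop) (mS t)]
    exact measure_congr (hset m t hmt)
  have hlev2 : ∀ m, MartLaw μX μY μZ m → ∀ t, (∀ᵐ q ∂m, t < F q.1 ↔ q.2 ∈ S t) →
      ∫ p in {p | t < F p}, p.2 ∂(m.map fun q => q.1) = ∫ z in S t, z ∂μZ := by
    intro m hm t hmt
    rw [hm.setIntegral_z hYb hZb (mF t), ← hm.mapZ,
      setIntegral_map (mS t) (Measurable.aestronglyMeasurable (by fun_prop)) (by fun_prop)]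
    exact setIntegral_congr_set (hset m t hmt)
  have hl₁ : ∀ t, ∀ᵐ q ∂m₁, t < F q.1 ↔ q.2 ∈ S t := fun t => (ae_of_ae_average (hlev t)).1
  have hl₂ : ∀ t, ∀ᵐ q ∂m₂, t < F q.1 ↔ q.2 ∈ S t := fun t => (ae_of_ae_average (hlev t)).2
  refine eq_of_level_eq (hmapX _ h₁.1) (hmapX _ h₂.1) hx hX hXna h01 h12 (hy3 _ h₁.1) (hy3 _ h₂.1)
    ((hyy _ h₁.1).trans (hyy _ h₂.1).symm)
    (fun C hC => (h₁.1.setIntegral_y hXb hYb hC).trans (h₂.1.setIntegral_y hXb hYb hC).symm)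
    hF (hanti y₀ my₀) (hanti y₁ my₁) hF₀₁
    (fun t => (hlev1 _ h₁.1 t (hl₁ t)).trans (hlev1 _ h₂.1 t (hl₂ t)).symm)
    (fun t => (hlev2 _ h₁.1 t (hl₁ t)).trans (hlev2 _ h₂.1 t (hl₂ t)).symm)

lemma regroup_injective : Function.Injective regroup := by
  intro π π' h
  apply ProbabilityMeasure.toMeasure_injective
  exact (MeasurableEquiv.map_measurableEquiv_injective _) h

lemma exists_regroup_eq (m : Measure ((ℝ × ℝ) × ℝ)) [IsProbabilityMeasure m] :
    ∃ π, regroup π = m :=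
  ⟨⟨m.map MeasurableEquiv.prodAssoc, Measure.isProbabilityMeasure_map
    MeasurableEquiv.prodAssoc.measurable.aemeasurable⟩, by
    simp only [regroup, ProbabilityMeasure.coe_mk]
    exact MeasurableEquiv.map_symm_map _⟩

lemma strictAntiOn_of_derivWithin_neg {g : ℝ → ℝ} {a b : ℝ} (hg : ContinuousOn g (Icc a b))
    (h : ∀ x ∈ Icc a b, derivWithin g (Icc a b) x < 0) : StrictAntiOn g (Icc a b) := by
  refine strictAntiOn_of_deriv_neg (convex_Icc a b) hg fun x hx => ?_
  rw [← derivWithin_of_mem_nhds (mem_interior_iff_mem_nhds.1 hx)]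
  exact h x (interior_subset hx)

end

theorem mainTheorem5
    (μX μY μZ : Measure ℝ)
    [IsProbabilityMeasure μX] [IsProbabilityMeasure μY] [IsProbabilityMeasure μZ]
    -- the marginals are in convex order
    (hXY : ConvexOrder μX μY) (hYZ : ConvexOrder μY μZ)
    -- `μX` lives on a compact interval and is absolutely continuous
    (xl xr : ℝ) (hX : μX (Icc xl xr)ᶜ = 0) (hXac : μX ≪ volume)
    -- `μY` is supported on three points
    (y₀ y₁ y₂ : ℝ) (hy₀₁ : y₀ < y₁) (hy₁₂ : y₁ < y₂)
    (a₀ a₁ a₂ : ℝ) (ha₀ : 0 < a₀) (ha₁ : 0 < a₁) (ha₂ : 0 < a₂)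
    (hY : μY = ENNReal.ofReal a₀ • Measure.dirac y₀ + ENNReal.ofReal a₁ • Measure.dirac y₁ +
      ENNReal.ofReal a₂ • Measure.dirac y₂)
    -- `μZ` lives on two compact intervals, on either side of the three points, and has no atoms
    (zl zl' zr zr' : ℝ) (hzl : zl' < y₀) (hzr : y₂ < zr)
    (hZ : μZ (Icc zl zl' ∪ Icc zr zr')ᶜ = 0)
    (hZna : ∀ z : ℝ, μZ {z} = 0)
    -- `f` is differentiable with negative partial derivatives
    (f : ℝ → ℝ → ℝ)
    (hf : DifferentiableOn ℝ (fun p : ℝ × ℝ => f p.1 p.2) (Icc xl xr ×ˢ Icc y₀ y₂))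
    (hfx : ∀ x ∈ Icc xl xr, ∀ y ∈ Icc y₀ y₂, derivWithin (fun t => f t y) (Icc xl xr) x < 0)
    (hfy : ∀ x ∈ Icc xl xr, ∀ y ∈ Icc y₀ y₂, derivWithin (fun s => f x s) (Icc y₀ y₂) y < 0) :
    ∃! π : ProbabilityMeasure (ℝ × ℝ × ℝ),
      IsOptimalMOT (fun x y z => f x y * z ^ 2) μX μY μZ π := by
  have hXI : ∀ᵐ x ∂μX, x ∈ Icc xl xr := by rw [ae_iff]; exact hX
  have hZI : ∀ᵐ z ∂μZ, z ∈ Icc zl zl' ∪ Icc zr zr' := by rw [ae_iff]; exact hZ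
  have hY3 : ∀ᵐ y ∂μY, y = y₀ ∨ y = y₁ ∨ y = y₂ := by
    rw [hY, ae_add_measure_iff, ae_add_measure_iff]
    refine ⟨⟨Measure.ae_smul_measure ?_ _, Measure.ae_smul_measure ?_ _⟩,
      Measure.ae_smul_measure ?_ _⟩ <;> simp [ae_dirac_eq]
  have hYI : ∀ᵐ y ∂μY, y ∈ Icc y₀ y₂ := by
    filter_upwards [hY3] with y h
    rcases h with h | h | h <;> rw [h] <;> constructor <;> linarith
  have hx : xl ≤ xr := by
    obtain ⟨x, hx⟩ := hXI.exists
    exact hx.1.trans hx.2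
  have hy02 : y₀ ≤ y₂ := (hy₀₁.trans hy₁₂).le
  obtain ⟨K, hK, k1, k2, k3, k4, k5, k6, k7, k8⟩ : ∃ K : ℝ, 0 < K ∧ |xl| ≤ K ∧ |xr| ≤ K ∧
      |y₀| ≤ K ∧ |y₂| ≤ K ∧ |zl| ≤ K ∧ |zl'| ≤ K ∧ |zr| ≤ K ∧ |zr'| ≤ K := by
    refine ⟨|xl| + |xr| + |y₀| + |y₂| + |zl| + |zl'| + |zr| + |zr'| + 1, by positivity, ?_, ?_, ?_,
      ?_, ?_, ?_, ?_, ?_⟩ <;>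
    linarith [abs_nonneg xl, abs_nonneg xr, abs_nonneg y₀, abs_nonneg y₂, abs_nonneg zl,
      abs_nonneg zl', abs_nonneg zr, abs_nonneg zr']
  rw [abs_le] at k1 k2 k3 k4 k5 k6 k7 k8
  have hXb : ∀ᵐ t ∂μX, |t| ≤ K := hXI.mono fun t h => abs_le.2 ⟨by linarith [h.1], by linarith [h.2]⟩
  have hYb : ∀ᵐ t ∂μY, |t| ≤ K := hYI.mono fun t h => abs_le.2 ⟨by linarith [h.1], by linarith [h.2]⟩
  have hZb : ∀ᵐ t ∂μZ, |t| ≤ K := hZI.mono fun t h => by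
    rcases h with h | h <;> exact abs_le.2 ⟨by linarith [h.1], by linarith [h.2]⟩
  have hZs : ∀ᵐ z ∂μZ, z ≤ zl' ∨ zr ≤ z := hZI.mono fun t h => h.imp (fun h => h.2) (fun h => h.1)
  have hna : NullSingletonClass μX := ⟨fun x => hXac (by simp)⟩
  -- a bounded continuous extension of `f`
  set F : ℝ × ℝ → ℝ := fun p => f (max xl (min xr p.1)) (max y₀ (min y₂ p.2)) with hFdef
  have hmem : ∀ p : ℝ × ℝ, (max xl (min xr p.1), max y₀ (min y₂ p.2)) ∈
      Icc xl xr ×ˢ Icc y₀ y₂ := fun p =>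
    ⟨⟨le_max_left _ _, max_le hx (min_le_left _ _)⟩,
      ⟨le_max_left _ _, max_le hy02 (min_le_left _ _)⟩⟩
  have hF : Continuous F := hf.continuousOn.comp_continuous (by fun_prop) hmem
  obtain ⟨B, hB⟩ := (isCompact_Icc.prod isCompact_Icc).exists_bound_of_continuousOn hf.continuousOn
  have hFB : ∀ p, |F p| ≤ B := fun p => hB _ (hmem p)
  have hFf : ∀ x ∈ Icc xl xr, ∀ y ∈ Icc y₀ y₂, F (x, y) = f x y := fun x hx y hy => by
    simp only [hFdef]
    rw [min_eq_right hx.2, max_eq_right hx.1, min_eq_right hy.2, max_eq_right hy.1]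
  have hcost : ∀ π : ProbabilityMeasure (ℝ × ℝ × ℝ), MartLaw μX μY μZ (regroup π) →
      ∫ p, f p.1 p.2.1 * p.2.2 ^ 2 ∂(π : Measure (ℝ × ℝ × ℝ)) =
        ∫ q, F q.1 * q.2 ^ 2 ∂(regroup π) := by
    intro π hπ
    rw [← integral_regroup π (fun q => f q.1.1 q.1.2 * q.2 ^ 2)]
    rw [← hπ.mapX] at hXI
    rw [← hπ.mapY] at hYI
    refine integral_congr_ae ?_
    filter_upwards [ae_of_ae_map (by fun_prop) hXI, ae_of_ae_map (by fun_prop) hYI] with q h1 h2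
    rw [← hFf _ h1 _ h2]
  -- Regrouping is a bijection of probability laws, and a feasible law only sees `F` on the
  -- rectangle where it equals `f`, so the two minimization problems coincide.
  have hopt : ∀ π, IsOptimalMOT (fun x y z => f x y * z ^ 2) μX μY μZ π ↔
      IsMinimizer μX μY μZ F (regroup π) := by
    intro π
    constructor
    · rintro ⟨h1, h2⟩
      rw [mem_martingaleCouplings_iff hXb hYb hZb] at h1
      refine ⟨h1, fun m' hm' => ?_⟩
      have := hm'.prob
      obtain ⟨π', rfl⟩ := exists_regroup_eq m'
      rw [← hcost π h1, ← hcost π' hm']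
      exact h2 π' ((mem_martingaleCouplings_iff hXb hYb hZb π').2 hm')
    · rintro ⟨h1, h2⟩
      refine ⟨(mem_martingaleCouplings_iff hXb hYb hZb π).2 h1, fun π' hπ' => ?_⟩
      rw [mem_martingaleCouplings_iff hXb hYb hZb] at hπ'
      simp only
      rw [hcost π h1, hcost π' hπ']
      exact h2 _ hπ'
  obtain ⟨m, hm, hmin⟩ := exists_minimizer_martLaw hK.le hXb hYb hZb
    (exists_martLaw hXY hYZ hXb hZb hy₀₁ hy₁₂ hzl hzr hZs ha₀ ha₁ ha₂ hY) hF hFB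
  have := hm.prob
  obtain ⟨π, rfl⟩ := exists_regroup_eq m
  refine ⟨π, (hopt π).2 ⟨hm, hmin⟩, fun π' hπ' => regroup_injective ?_⟩
  refine IsMinimizer.unique hK hXb hYb hZb hx hXI hy₀₁ hy₁₂ hzl hzr (by linarith) (by linarith)
    hY3 hZs hZna hF hFB (fun y hy => ?_) (fun x hx => ?_) ((hopt π').1 hπ') ⟨hm, hmin⟩
  · have h1 : StrictAntiOn (fun t => f t y) (Icc xl xr) :=
      strictAntiOn_of_derivWithin_neg
        (hf.continuousOn.comp (f := fun t : ℝ => (t, y)) (by fun_prop) fun t ht => ⟨ht, hy⟩)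
        fun x hx => hfx x hx y hy
    intro a ha b hb hab
    simp only [hFf a ha y hy, hFf b hb y hy]
    exact h1 ha hb hab
  · have h1 : StrictAntiOn (fun s => f x s) (Icc y₀ y₂) :=
      strictAntiOn_of_derivWithin_neg
        (hf.continuousOn.comp (f := fun s : ℝ => (x, s)) (by fun_prop) fun s hs => ⟨hx, hs⟩)
        fun y hy => hfy x hx y hy
    rw [hFf x hx y₀ ⟨le_rfl, hy02⟩, hFf x hx y₁ ⟨hy₀₁.le, hy₁₂.le⟩]
    exact h1 ⟨le_rfl, hy02⟩ ⟨hy₀₁.le, hy₁₂.le⟩ hy₀₁
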